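/- Let $G=(V,E)$ be a (possibly infinite) locally finite undirected graph and let $W=(W_{u,w})_{u,w\in V}$ be a gossip matrix on $G$: $W_{u,w}\ge 0$ for all $u,w$; for $u\neq w$, $W_{u,w}>0$ only if $\{u,w\}\in E$; $\sum_{w\in V}W_{u,w}=1$ for all $u$; and $W_{u,w}=W_{w,u}$ for all $u,w$. Let $\nu$ be a probability law on $\mathbb R$ with a finite mean $\mu=\int_{\mathbb R}x\,\mathrm d\nu(x)$, and let $\xi=(\xi_w)_{w\in V}$ be i.i.d. random variables with law $\nu$. Fix $v\in V$. Let $p_t$ be the probability that the lazy random walk with transition matrix $(I+W)/2$, started from $v$, is at $v$ at time $t$, and assume that the spectral dimension $$d_s=-2\lim_{t\to\infty}\frac{\ln p_t}{\ln t}$$ exists and is finite. 1. Suppose that $\nu$ is not a point mass (its variance is nonzero, possibly infinite). Let $x^t$ be the iterates of simple gossip, $x^0=\xi$, $x^{t+1}=Wx^t$ $(t\ge 0)$, or the iterates of shift-register gossip with some parameter $\omega\in[1,2)$, $x^0=\xi$, $x^1=W\xi$, $x^{t+1}=\omega Wx^t+(1-\omega)x^{t-1}$ $(t\ge1)$. Then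 $$\liminf_{t\to\infty}\frac{\ln\mathbb E[(x^t_v-\mu)^2]}{\ln t}\ge-\frac{d_s}{2}.$$ 2. Suppose that $\nu$ has finite variance. Let $x^t$ be the iterates of the Jacobi polynomial iteration with parameter $d=d_s$, that is $x^0=\xi$, $x^1=a_0W\xi+b_0\xi$, $x^{t+1}=a_tWx^t+b_tx^t-c_tx^{t-1}$ $(t\ge1)$, where $$a_0=\frac{d+4}{2(2+d)},\qquad b_0=\frac{d}{2(2+d)},$$ and, for $t\ge1$, $$a_t=\frac{(2t+\frac d2+1)(2t+\frac d2+2)}{2(t+1+\frac d2)^2},\qquad b_t=\frac{d^2(2t+\frac d2+1)}{8(t+1+\frac d2)^2(2t+\frac d2)},\qquad c_t=\frac{t^2(2t+\frac d2+2)}{(t+1+\frac d2)^2(2t+\frac d2)}.$$ Then $$\limsup_{t\to\infty}\frac{\ln\mathbb E[(x^t_v-\mu)^2]}{\ln t}\le-d_s.$$ Here $\ln 0=-\infty$ and $\ln(+\infty)=+\infty$. -/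

import Mathlib

open MeasureTheory ProbabilityTheory Filter Topology

noncomputable section

namespace Gossip

/-- `W` is a gossip matrix on the graph `G`: nonnegative, supported by `G` (diagonal entries are
allowed), stochastic and symmetric. -/
structure IsGossipMatrix {V : Type*} (G : SimpleGraph V) (W : Matrix V V ℝ) : Prop where
  nonneg : ∀ v w, 0 ≤ W v w
  adj_of_pos : ∀ v w, v ≠ w → 0 < W v w → G.Adj v w
  row_sum : ∀ v, ∑ᶠ w, W v w = 1
  symm : ∀ v w, W v w = W w v

/-- The product `W x`. If `W` is a gossip matrix, each of these sums has finitely many nonzero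
terms. -/
def apply {V : Type*} (W : Matrix V V ℝ) (x : V → ℝ) : V → ℝ :=
  fun v => ∑ᶠ w, W v w * x w

/-- The entry `(u, w)` of `(I + W) / 2`, as an extended nonnegative real. -/
def lazyEntry {V : Type*} (W : Matrix V V ℝ) (u w : V) : ENNReal :=
  open Classical in ENNReal.ofReal (((if u = w then 1 else 0) + W u w) / 2)

theorem IsGossipMatrix.hasSum_lazyEntry {V : Type*} {G : SimpleGraph V} {W : Matrix V V ℝ}
    (hW : IsGossipMatrix G W) (u : V) : HasSum (lazyEntry W u) 1 := by
  classical
  have hfin : (Function.support (W u)).Finite := by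
    by_contra h
    have h1 := hW.row_sum u
    rw [finsum_of_infinite_support h] at h1
    exact zero_ne_one h1
  set s : Finset V := insert u hfin.toFinset with hs
  have h0 : ∀ w, w ∉ s → W u w = 0 := by
    intro w hw
    by_contra hne
    exact hw (by simp [hs, hne])
  have hsum : ∑ w ∈ s, W u w = 1 := by
    rw [← hW.row_sum u]
    refine (finsum_eq_sum_of_support_subset _ ?_).symm
    intro w hw
    by_contra hne
    exact hw (h0 w hne)
  have key : ∑ w ∈ s, lazyEntry W u w = 1 := by
    unfold lazyEntry
    rw [← ENNReal.ofReal_sum_of_nonneg]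
    · rw [← Finset.sum_div, Finset.sum_add_distrib, hsum, Finset.sum_ite_eq]
      simp [hs]
    · intro w _
      have := hW.nonneg u w
      split_ifs <;> positivity
  rw [← key]
  apply hasSum_sum_of_ne_finset_zero
  intro w hw
  have hne : u ≠ w := by
    rintro rfl
    exact hw (by simp [hs])
  simp [lazyEntry, h0 w hw, hne]

/-- One step, from `u`, of the lazy random walk with transition matrix `(I + W) / 2`. -/
def lazyStep {V : Type*} {G : SimpleGraph V} {W : Matrix V V ℝ} (hW : IsGossipMatrix G W)
    (u : V) : PMF V :=
  ⟨lazyEntry W u, hW.hasSum_lazyEntry u⟩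

/-- The law at time `t` of the lazy random walk started from `v`. -/
def lazyWalkLaw {V : Type*} {G : SimpleGraph V} {W : Matrix V V ℝ} (hW : IsGossipMatrix G W)
    (v : V) : ℕ → PMF V
  | 0 => PMF.pure v
  | t + 1 => (lazyWalkLaw hW v t).bind (lazyStep hW)

/-- The probability that the lazy random walk started from `v` is at `v` at time `t`. -/
def returnProb {V : Type*} {G : SimpleGraph V} {W : Matrix V V ℝ} (hW : IsGossipMatrix G W)
    (v : V) (t : ℕ) : ℝ :=
  (lazyWalkLaw hW v t v).toReal

/-- The spectral dimension of `(G, W)` at `v` exists, is finite and equals `ds`. -/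
def HasSpectralDimension {V : Type*} {G : SimpleGraph V} {W : Matrix V V ℝ}
    (hW : IsGossipMatrix G W) (v : V) (ds : ℝ) : Prop :=
  Tendsto (fun t : ℕ => -2 * (Real.log (returnProb hW v t) / Real.log t)) atTop (𝓝 ds)

/-- Simple gossip started from `ξ`. -/
def simpleGossip {V : Type*} (W : Matrix V V ℝ) (ξ : V → ℝ) : ℕ → V → ℝ
  | 0 => ξ
  | t + 1 => apply W (simpleGossip W ξ t)

/-- Shift-register gossip with parameter `ω`, started from `ξ`. -/
def shiftRegister {V : Type*} (ω : ℝ) (W : Matrix V V ℝ) (ξ : V → ℝ) : ℕ → V → ℝ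
  | 0 => ξ
  | 1 => apply W ξ
  | t + 2 => ω • apply W (shiftRegister ω W ξ (t + 1)) + (1 - ω) • shiftRegister ω W ξ t

/-- The coefficient `a_t` of the Jacobi polynomial iteration with parameter `d`. -/
def jacobiA (d : ℝ) (t : ℕ) : ℝ :=
  if t = 0 then (d + 4) / (2 * (2 + d))
  else (2 * t + d / 2 + 1) * (2 * t + d / 2 + 2) / (2 * (t + 1 + d / 2) ^ 2)

/-- The coefficient `b_t` of the Jacobi polynomial iteration with parameter `d`. -/
def jacobiB (d : ℝ) (t : ℕ) : ℝ :=
  if t = 0 then d / (2 * (2 + d))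
  else d ^ 2 * (2 * t + d / 2 + 1) / (8 * (t + 1 + d / 2) ^ 2 * (2 * t + d / 2))

/-- The coefficient `c_t`, `t ≥ 1`, of the Jacobi polynomial iteration with parameter `d`. -/
def jacobiC (d : ℝ) (t : ℕ) : ℝ :=
  t ^ 2 * (2 * t + d / 2 + 2) / ((t + 1 + d / 2) ^ 2 * (2 * t + d / 2))

/-- The Jacobi polynomial iteration with parameter `d`, started from `ξ`. -/
def jacobiIteration {V : Type*} (d : ℝ) (W : Matrix V V ℝ) (ξ : V → ℝ) : ℕ → V → ℝ
  | 0 => ξ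
  | 1 => jacobiA d 0 • apply W ξ + jacobiB d 0 • ξ
  | t + 2 => jacobiA d (t + 1) • apply W (jacobiIteration d W ξ (t + 1))
      + jacobiB d (t + 1) • jacobiIteration d W ξ (t + 1)
      - jacobiC d (t + 1) • jacobiIteration d W ξ t

/-- The mean square error `E[(X - m)²]`, possibly infinite. -/
def mse {Ω : Type*} [MeasurableSpace Ω] (P : Measure Ω) (X : Ω → ℝ) (m : ℝ) : ENNReal :=
  ∫⁻ ω, ENNReal.ofReal ((X ω - m) ^ 2) ∂P

/-- `ln e_t / ln t` in the extended reals, with `ln 0 = -∞` and `ln ∞ = ∞`. -/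
def logRate (e : ℕ → ENNReal) (t : ℕ) : EReal :=
  ENNReal.log (e t) / ((Real.log t : ℝ) : EReal)

end Gossip

end

/-! Each iterate is a polynomial p_t of W applied to ξ, with p_t(1) = 1. Let σ be the spectral
measure of W at v, on [-1, 1]. The coefficients of the iterate at v sum to 1 and their squares sum
to ∫ p_t² dσ (`exists_row`), so for finite variance the mean square error is Var(ν) ∫ p_t² dσ. The
return probability is ∫ ((1 + x) / 2)^T dσ. Both parts thus reduce to pointwise comparisons of p_t²
with powers of (1 + x) / 2. No measure σ is built: a fixed degree only sees a finite ball, where the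
spectral theorem for matrices applies (`exists_spectral_measure`).

Lower bound: the shift-register polynomial is at least 1/2 for 1 - x ≤ 1 / (2Kt), with K = 4 / (2 -
ω) (`pow_le_eval_shiftPoly`), while the lazy walk at time about t^(1 + ε) gives
stretched-exponentially little weight to the rest (`lazy_pow_le_shiftPoly`). If the variance is
infinite, so is every error (`mse_eq_top`).

Upper bound: with a = d / 2, the Jacobi iteration produces the (a, 0) Jacobi polynomials normalized
at 1, and (1 - x)^a p_n(x)² = O(n^(-2a)) by monotone energies of Sonin type
(`exists_rpow_mul_jacobiPoly_sq_le`). Splitting 1 - x dyadically turns this into a sum of return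
polynomials at times 2^j ≤ n² (`exists_eval_jacobiPoly_sq_le`), which the spectral dimension
controls. -/

namespace Gossip

open Polynomial

variable {V : Type*} {G : SimpleGraph V} {W : Matrix V V ℝ}

/-! ### Polynomials in W, finite truncations and the spectral measure. -/

theorem IsGossipMatrix.finite_support (hW : IsGossipMatrix G W) (u : V) :
    (Function.support (W u)).Finite := by
  by_contra h
  have h1 := hW.row_sum u
  rw [finsum_of_infinite_support h] at h1
  exact zero_ne_one h1

theorem apply_eq_sum (x : V → ℝ) (u : V) (s : Finset V)
    (hs : Function.support (W u) ⊆ s) : apply W x u = ∑ w ∈ s, W u w * x w :=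
  finsum_eq_sum_of_support_subset _ fun _ hw => hs (left_ne_zero_of_mul hw)

theorem IsGossipMatrix.apply_eq_sum_support (hW : IsGossipMatrix G W) (x : V → ℝ) (u : V) :
    apply W x u = ∑ w ∈ (hW.finite_support u).toFinset, W u w * x w :=
  apply_eq_sum x u _ (by simp)

/-- The operator `x ↦ W x` on functions on the vertices. -/
noncomputable def IsGossipMatrix.toLin (hW : IsGossipMatrix G W) : Module.End ℝ (V → ℝ) where
  toFun := apply W
  map_add' x y := by
    ext u
    simp only [hW.apply_eq_sum_support, Pi.add_apply, mul_add, Finset.sum_add_distrib]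
  map_smul' c x := by
    ext u
    simp only [hW.apply_eq_sum_support, Pi.smul_apply, smul_eq_mul, Finset.mul_sum,
      RingHom.id_apply]
    exact Finset.sum_congr rfl fun w _ => by ring

@[simp]
theorem IsGossipMatrix.toLin_apply (hW : IsGossipMatrix G W) (x : V → ℝ) :
    hW.toLin x = apply W x := rfl

theorem IsGossipMatrix.apply_one (hW : IsGossipMatrix G W) : apply W 1 = 1 := by
  ext u
  simp [apply, hW.row_sum u]

theorem IsGossipMatrix.aeval_toLin_one (hW : IsGossipMatrix G W) (p : ℝ[X]) :
    aeval hW.toLin p 1 = p.eval 1 • (1 : V → ℝ) := by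
  have h : ∀ n : ℕ, (hW.toLin ^ n) 1 = 1 := by
    intro n
    induction n with
    | zero => simp
    | succ n ih => rw [pow_succ', Module.End.mul_apply, ih, hW.toLin_apply, hW.apply_one]
  rw [aeval_eq_sum_range, eval_eq_sum_range]
  simp [h, LinearMap.sum_apply, Finset.sum_smul]

open Classical in
/-- The vertices reached from `v` by at most `k` steps along nonzero entries of `W`. -/
noncomputable def IsGossipMatrix.reach (hW : IsGossipMatrix G W) (v : V) : ℕ → Finset V
  | 0 => {v}
  | k + 1 => hW.reach v k ∪ (hW.reach v k).biUnion fun u => (hW.finite_support u).toFinset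

theorem IsGossipMatrix.reach_mono (hW : IsGossipMatrix G W) (v : V) : Monotone (hW.reach v) :=
  monotone_nat_of_le_succ fun k => by
    classical
    rw [IsGossipMatrix.reach]
    exact Finset.subset_union_left

theorem IsGossipMatrix.support_subset_reach (hW : IsGossipMatrix G W) {v u : V} {k : ℕ}
    (hu : u ∈ hW.reach v k) : Function.support (W u) ⊆ hW.reach v (k + 1) := by
  classical
  intro w hw
  rw [IsGossipMatrix.reach, Finset.mem_coe, Finset.mem_union, Finset.mem_biUnion]
  exact Or.inr ⟨u, hu, by simpa using hw⟩

theorem IsGossipMatrix.mem_reach (hW : IsGossipMatrix G W) (v : V) (k : ℕ) :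
    v ∈ hW.reach v k :=
  hW.reach_mono v (Nat.zero_le k) (by simp [IsGossipMatrix.reach])

/-- The restriction of `W` to the vertices reached from `v` in at most `N` steps. -/
noncomputable def IsGossipMatrix.trunc (hW : IsGossipMatrix G W) (v : V) (N : ℕ) :
    Matrix (hW.reach v N) (hW.reach v N) ℝ :=
  W.submatrix (↑) (↑)

open Classical in
-- A walk of j steps started inside the ball of radius k stays inside the ball of radius k + j ≤ N,
-- so truncation does not change it.
theorem IsGossipMatrix.toLin_pow_apply (hW : IsGossipMatrix G W) (v : V) (N : ℕ) (x : V → ℝ)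
    (j : ℕ) : ∀ k, k + j ≤ N → ∀ u : hW.reach v N, (u : V) ∈ hW.reach v k →
      (hW.toLin ^ j) x u = ((hW.trunc v N ^ j).mulVec fun w => x w) u := by
  induction j with
  | zero => intro k _ u _; simp
  | succ j ih =>
    intro k hk u hu
    rw [pow_succ', Module.End.mul_apply, hW.toLin_apply, pow_succ', ← Matrix.mulVec_mulVec,
      apply_eq_sum _ _ (hW.reach v N)
        ((hW.support_subset_reach hu).trans (hW.reach_mono v (by omega))),
      ← Finset.sum_coe_sort (hW.reach v N)]
    simp only [Matrix.mulVec, dotProduct]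
    refine Finset.sum_congr rfl fun w _ => ?_
    rcases eq_or_ne (W u w) 0 with h0 | h0
    · simp [IsGossipMatrix.trunc, h0]
    · rw [ih (k + 1) (by omega) w (hW.support_subset_reach hu h0)]
      rfl

open Classical in
theorem IsGossipMatrix.aeval_toLin_apply (hW : IsGossipMatrix G W) (v : V) {N : ℕ} {p : ℝ[X]}
    (hp : p.natDegree ≤ N) (x : V → ℝ) :
    aeval hW.toLin p x v
      = ∑ w, aeval (hW.trunc v N) p ⟨v, hW.mem_reach v N⟩ w * x w := by
  change _ = ((aeval (hW.trunc v N) p).mulVec fun w => x w) ⟨v, hW.mem_reach v N⟩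
  rw [aeval_eq_sum_range, aeval_eq_sum_range, LinearMap.sum_apply, Finset.sum_apply,
    Matrix.sum_mulVec, Finset.sum_apply]
  refine Finset.sum_congr rfl fun j hj => ?_
  have hj' := Finset.mem_range_succ_iff.mp hj
  rw [Matrix.smul_mulVec, LinearMap.smul_apply, Pi.smul_apply, Pi.smul_apply,
    ← hW.toLin_pow_apply v N x j 0 (by omega) ⟨v, hW.mem_reach v N⟩ (hW.mem_reach v 0)]

theorem IsGossipMatrix.isHermitian_trunc (hW : IsGossipMatrix G W) (v : V) (N : ℕ) :
    (hW.trunc v N).IsHermitian := by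
  ext i j
  simp [IsGossipMatrix.trunc, hW.symm j i]

theorem IsGossipMatrix.sum_le_one (hW : IsGossipMatrix G W) (u : V) (s : Finset V) :
    ∑ w ∈ s, W u w ≤ 1 := by
  classical
  have h : ∑ w ∈ s ∪ (hW.finite_support u).toFinset, W u w = 1 := by
    have h1 := apply_eq_sum (W := W) 1 u (s ∪ (hW.finite_support u).toFinset) (by simp)
    rw [hW.apply_one] at h1
    simpa using h1.symm
  rw [← h]
  exact Finset.sum_le_sum_of_subset_of_nonneg Finset.subset_union_left fun w _ _ => hW.nonneg u w

open Classical in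
-- Gershgorin: truncated rows are nonnegative with sum at most 1, so every disc lies in [-1, 1].
theorem IsGossipMatrix.abs_eigenvalues_trunc_le (hW : IsGossipMatrix G W) (v : V) (N : ℕ)
    (i : hW.reach v N) : |(hW.isHermitian_trunc v N).eigenvalues i| ≤ 1 := by
  set μ := (hW.isHermitian_trunc v N).eigenvalues i
  have hev : Module.End.HasEigenvalue (Matrix.toLin' (hW.trunc v N)) μ := by
    refine Module.End.hasEigenvalue_of_hasEigenvector
      (x := ⇑((hW.isHermitian_trunc v N).eigenvectorBasis i)) ⟨?_, ?_⟩
    · rw [Module.End.mem_eigenspace_iff, Matrix.toLin'_apply]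
      exact (hW.isHermitian_trunc v N).mulVec_eigenvectorBasis i
    · intro h
      have := (hW.isHermitian_trunc v N).eigenvectorBasis.orthonormal.ne_zero i
      exact this (by ext j; exact congrFun h j)
  obtain ⟨k, hk⟩ := eigenvalue_mem_ball hev
  rw [mem_closedBall_iff_norm, Real.norm_eq_abs] at hk
  have h0 : ∀ j, 0 ≤ hW.trunc v N k j := fun j => hW.nonneg _ _
  have h1 : ∑ j, hW.trunc v N k j ≤ 1 := by
    have := hW.sum_le_one k (hW.reach v N)
    rwa [← Finset.sum_coe_sort] at this
  rw [← Finset.add_sum_erase _ _ (Finset.mem_univ k)] at h1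
  simp only [Real.norm_eq_abs, abs_of_nonneg (h0 _)] at hk
  have h2 := h0 k
  rw [abs_le] at hk ⊢
  constructor <;> linarith

/-- The diagonal entry of a polynomial in a real symmetric matrix, in spectral form. -/
theorem _root_.Matrix.IsHermitian.aeval_diag_eq_sum {n : Type*} [Fintype n] [DecidableEq n]
    {A : Matrix n n ℝ} (hA : A.IsHermitian) (p : ℝ[X]) (i : n) :
    aeval A p i i = ∑ k, (hA.eigenvectorBasis k i) ^ 2 * p.eval (hA.eigenvalues k) := by
  have hpow : ∀ j : ℕ, ∀ k, (A ^ j).mulVec ⇑(hA.eigenvectorBasis k)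
      = hA.eigenvalues k ^ j • ⇑(hA.eigenvectorBasis k) := by
    intro j k
    induction j with
    | zero => simp
    | succ j ih =>
      rw [pow_succ', ← Matrix.mulVec_mulVec, ih, Matrix.mulVec_smul, hA.mulVec_eigenvectorBasis,
        smul_smul, pow_succ]
  have hvec : ∀ k, (aeval A p).mulVec ⇑(hA.eigenvectorBasis k)
      = p.eval (hA.eigenvalues k) • ⇑(hA.eigenvectorBasis k) := by
    intro k
    rw [aeval_eq_sum_range, eval_eq_sum_range, Matrix.sum_mulVec, Finset.sum_smul]
    exact Finset.sum_congr rfl fun j _ => by rw [Matrix.smul_mulVec, hpow, smul_smul]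
  -- The weights of the spectral measure are the squared coordinates of the basis vector in the
  -- eigenbasis.
  have hsingle : (Pi.single i 1 : n → ℝ)
      = ∑ k, hA.eigenvectorBasis k i • ⇑(hA.eigenvectorBasis k) := by
    have h := hA.eigenvectorBasis.sum_repr (EuclideanSpace.single i (1 : ℝ))
    ext j
    have hj := congrArg (fun z : EuclideanSpace ℝ n => z j) h
    simp only [OrthonormalBasis.repr_apply_apply, EuclideanSpace.inner_single_right] at hj
    simpa [Pi.single_apply] using hj.symm
  have h : aeval A p i i = (aeval A p).mulVec (Pi.single i 1) i := by simp
  rw [h, hsingle, Matrix.mulVec_sum, Finset.sum_apply]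
  refine Finset.sum_congr rfl fun k _ => ?_
  rw [Matrix.mulVec_smul, hvec]
  simp only [Pi.smul_apply, smul_eq_mul]
  ring

theorem _root_.Matrix.IsHermitian.sum_aeval_sq {n : Type*} [Fintype n] [DecidableEq n]
    {A : Matrix n n ℝ} (hA : A.IsHermitian) (p : ℝ[X]) (i : n) :
    ∑ j, aeval A p i j ^ 2 = aeval A (p ^ 2) i i := by
  have hsymm : (aeval A p).transpose = aeval A p := by
    have hA' : A.transpose = A := by
      rw [← Matrix.conjTranspose_eq_transpose_of_trivial]
      exact hA
    rw [aeval_eq_sum_range, Matrix.transpose_sum]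
    exact Finset.sum_congr rfl fun j _ => by
      rw [Matrix.transpose_smul, Matrix.transpose_pow, hA']
  rw [map_pow, sq, Matrix.mul_apply]
  exact Finset.sum_congr rfl fun j _ => by
    rw [sq]
    congr 1
    exact congrFun (congrFun hsymm j) i

open Classical in
/-- Polynomials in `W` of degree at most `N`, read at `v`, are those of a finitely supported
spectral measure on `[-1, 1]`. -/
theorem IsGossipMatrix.exists_spectral_measure (hW : IsGossipMatrix G W) (v : V) (N : ℕ) :
    ∃ (B : Finset V) (wt node : B → ℝ), (∀ i, 0 ≤ wt i) ∧ (∀ i, |node i| ≤ 1) ∧ ∑ i, wt i = 1 ∧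
      ∀ p : ℝ[X], p.natDegree ≤ N →
        aeval hW.toLin p (Pi.single v 1) v = ∑ i, wt i * p.eval (node i) ∧
        ∃ c : B → ℝ, (∀ x : V → ℝ, aeval hW.toLin p x v = ∑ w, c w * x w) ∧
          ∑ w, c w ^ 2 = ∑ i, wt i * p.eval (node i) ^ 2 := by
  have hdiag : ∀ p : ℝ[X], p.natDegree ≤ N → aeval hW.toLin p (Pi.single v 1) v
      = ∑ i, (hW.isHermitian_trunc v N).eigenvectorBasis i ⟨v, hW.mem_reach v N⟩ ^ 2
        * p.eval ((hW.isHermitian_trunc v N).eigenvalues i) := by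
    intro p hp
    rw [hW.aeval_toLin_apply v hp, ← (hW.isHermitian_trunc v N).aeval_diag_eq_sum,
      Finset.sum_eq_single ⟨v, hW.mem_reach v N⟩]
    · simp
    · intro b _ hb
      rw [Pi.single_eq_of_ne, mul_zero]
      exact fun h => hb (Subtype.ext h)
    · simp
  refine ⟨hW.reach v N,
    fun i => (hW.isHermitian_trunc v N).eigenvectorBasis i ⟨v, hW.mem_reach v N⟩ ^ 2,
    (hW.isHermitian_trunc v N).eigenvalues, fun i => sq_nonneg _,
    hW.abs_eigenvalues_trunc_le v N, ?_, fun p hp => ⟨hdiag p hp,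
      aeval (hW.trunc v N) p ⟨v, hW.mem_reach v N⟩, hW.aeval_toLin_apply v hp, ?_⟩⟩
  · have h := hdiag 1 (by simp)
    simpa using h.symm
  · rw [(hW.isHermitian_trunc v N).sum_aeval_sq, (hW.isHermitian_trunc v N).aeval_diag_eq_sum]
    simp

/-! ### The lazy walk and the iterations as polynomials in W. -/

/-- The transition polynomial of the lazy random walk. -/
noncomputable def lazyPoly : ℝ[X] := C (1 / 2) * (1 + X)

theorem natDegree_lazyPoly_pow_le (t : ℕ) : (lazyPoly ^ t).natDegree ≤ t := by
  have h : lazyPoly.natDegree ≤ 1 := by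
    unfold lazyPoly
    compute_degree
  simpa using natDegree_pow_le_of_le t h

theorem IsGossipMatrix.lazyEntry_comm (hW : IsGossipMatrix G W) (u w : V) :
    lazyEntry W u w = lazyEntry W w u := by
  by_cases h : u = w
  · subst h; rfl
  · simp [lazyEntry, hW.symm u w, h, Ne.symm h]

open Classical in
-- The law evolves by the transposed matrix; symmetry of W makes this the action of the operator
-- itself on the point mass at v.
theorem IsGossipMatrix.toReal_lazyWalkLaw (hW : IsGossipMatrix G W) (v : V) (t : ℕ) :
    (fun u => (lazyWalkLaw hW v t u).toReal) = aeval hW.toLin (lazyPoly ^ t) (Pi.single v 1) := by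
  induction t with
  | zero =>
    ext u
    by_cases h : u = v <;> simp [lazyWalkLaw, PMF.pure_apply, h]
  | succ t ih =>
    rw [pow_succ', map_mul, Module.End.mul_apply, ← ih]
    ext u
    have hzero : ∀ w ∉ insert u (hW.finite_support u).toFinset, lazyEntry W u w = 0 := by
      intro w hw
      simp only [Finset.mem_insert, Set.Finite.mem_toFinset, Function.mem_support, not_or,
        not_not] at hw
      simp [lazyEntry, hw.2, Ne.symm hw.1]
    simp only [lazyWalkLaw, PMF.bind_apply]
    have h1 : ∀ w, lazyWalkLaw hW v t w * lazyStep hW w u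
        = lazyEntry W u w * lazyWalkLaw hW v t w := by
      intro w
      rw [mul_comm, hW.lazyEntry_comm]
      rfl
    simp only [h1]
    rw [tsum_eq_sum (s := insert u (hW.finite_support u).toFinset)
      fun w hw => by rw [hzero w hw, zero_mul], ENNReal.toReal_sum (f := fun w =>
        lazyEntry W u w * lazyWalkLaw hW v t w)
      fun w _ => ENNReal.mul_ne_top ENNReal.ofReal_ne_top (PMF.apply_ne_top _ _)]
    simp only [lazyPoly, map_mul, aeval_C, map_add, map_one, aeval_X, Module.End.mul_apply,
      LinearMap.add_apply, Module.End.one_apply, hW.toLin_apply, Module.algebraMap_end_apply,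
      Pi.smul_apply, Pi.add_apply, smul_eq_mul]
    rw [apply_eq_sum _ u (insert u (hW.finite_support u).toFinset) (by simp)]
    have h2 : ∀ w, (lazyEntry W u w * lazyWalkLaw hW v t w).toReal
        = 1 / 2 * ((if u = w then (lazyWalkLaw hW v t w).toReal else 0)
          + W u w * (lazyWalkLaw hW v t w).toReal) := by
      intro w
      rw [ENNReal.toReal_mul, lazyEntry, ENNReal.toReal_ofReal]
      · split_ifs <;> ring
      · have := hW.nonneg u w
        split_ifs <;> positivity
    simp only [h2, ← Finset.mul_sum, Finset.sum_add_distrib, Finset.sum_ite_eq]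
    simp [mul_add]

open Classical in
theorem IsGossipMatrix.returnProb_eq (hW : IsGossipMatrix G W) (v : V) (t : ℕ) :
    returnProb hW v t = aeval hW.toLin (lazyPoly ^ t) (Pi.single v 1) v :=
  congrFun (hW.toReal_lazyWalkLaw v t) v

theorem IsGossipMatrix.returnProb_pos (hW : IsGossipMatrix G W) (v : V) (t : ℕ) :
    0 < returnProb hW v t := by
  refine ENNReal.toReal_pos ?_ (PMF.apply_ne_top _ _)
  induction t with
  | zero => simp [lazyWalkLaw]
  | succ t ih =>
    rw [lazyWalkLaw, PMF.bind_apply]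
    refine (lt_of_lt_of_le ?_ (ENNReal.le_tsum v)).ne'
    have h : lazyStep hW v v ≠ 0 := by
      change lazyEntry W v v ≠ 0
      have := hW.nonneg v v
      simp only [lazyEntry, if_true, ne_eq, ENNReal.ofReal_eq_zero, not_le]
      positivity
    exact pos_iff_ne_zero.mpr (mul_ne_zero ih h)

theorem IsGossipMatrix.returnProb_le_one (hW : IsGossipMatrix G W) (v : V) (t : ℕ) :
    returnProb hW v t ≤ 1 :=
  ENNReal.toReal_le_of_le_ofReal zero_le_one (by simpa using PMF.coe_le_one _ _)

/-- The polynomials of shift-register gossip. -/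
noncomputable def shiftPoly (ω : ℝ) : ℕ → ℝ[X]
  | 0 => 1
  | 1 => X
  | t + 2 => C ω * X * shiftPoly ω (t + 1) + C (1 - ω) * shiftPoly ω t

/-- The polynomials of the Jacobi polynomial iteration. -/
noncomputable def jacobiPoly (d : ℝ) : ℕ → ℝ[X]
  | 0 => 1
  | 1 => C (jacobiA d 0) * X + C (jacobiB d 0)
  | t + 2 => (C (jacobiA d (t + 1)) * X + C (jacobiB d (t + 1))) * jacobiPoly d (t + 1)
      - C (jacobiC d (t + 1)) * jacobiPoly d t

theorem IsGossipMatrix.shiftRegister_eq (hW : IsGossipMatrix G W) (ω : ℝ) (x : V → ℝ) (t : ℕ) :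
    shiftRegister ω W x t = aeval hW.toLin (shiftPoly ω t) x := by
  induction t using Nat.twoStepInduction with
  | zero => simp [shiftPoly, shiftRegister]
  | one => simp [shiftPoly, shiftRegister]
  | more t ih1 ih2 =>
    rw [shiftPoly, shiftRegister, ih1, ih2]
    simp [Module.End.mul_apply, Module.algebraMap_end_apply, sub_smul]

theorem IsGossipMatrix.jacobiIteration_eq (hW : IsGossipMatrix G W) (d : ℝ) (x : V → ℝ) (t : ℕ) :
    jacobiIteration d W x t = aeval hW.toLin (jacobiPoly d t) x := by
  induction t using Nat.twoStepInduction with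
  | zero => simp [jacobiPoly, jacobiIteration]
  | one =>
    simp [jacobiPoly, jacobiIteration, Module.End.mul_apply, Module.algebraMap_end_apply]
  | more t ih1 ih2 =>
    rw [jacobiPoly, jacobiIteration, ih1, ih2]
    simp [Module.End.mul_apply, Module.algebraMap_end_apply]

/-- At ω = 1 the memory term vanishes, so one lower bound serves both methods. -/
theorem simpleGossip_eq_shiftRegister (W : Matrix V V ℝ) (x : V → ℝ) (t : ℕ) :
    simpleGossip W x t = shiftRegister 1 W x t := by
  induction t using Nat.twoStepInduction with
  | zero => rfl
  | one => rfl
  | more t ih1 ih2 => rw [simpleGossip, shiftRegister, ih2]; simp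

/-! ### Jacobi polynomials: recurrence, structure relations, differential equation. -/

theorem eval_jacobiPoly_one {a : ℝ} (ha : 0 ≤ a) (x : ℝ) :
    (jacobiPoly (2 * a) 1).eval x = (a + 2) / (2 * (1 + a)) * x + a / (2 * (1 + a)) := by
  have h : (1 + a) ≠ 0 := by positivity
  have h' : (2 + 2 * a) ≠ 0 := by positivity
  simp only [jacobiPoly, jacobiA, jacobiB, if_true, eval_add, eval_mul, eval_C, eval_X]
  field_simp
  ring

theorem eval_derivative_jacobiPoly_one {a : ℝ} (ha : 0 ≤ a) (x : ℝ) :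
    (derivative (jacobiPoly (2 * a) 1)).eval x = (a + 2) / (2 * (1 + a)) := by
  have h : (1 + a) ≠ 0 := by positivity
  have h' : (2 + 2 * a) ≠ 0 := by positivity
  simp only [jacobiPoly, jacobiA, jacobiB, if_true]
  simp
  field_simp
  ring

/-- The three-term recurrence of the Jacobi polynomials with parameters `(a, 0)`, normalized to
take the value `1` at `1`. -/
theorem eval_jacobiPoly_add_two {a : ℝ} (ha : 0 ≤ a) (n : ℕ) (x : ℝ) :
    2 * (n + 2 + a) ^ 2 * (2 * n + 2 + a) * (jacobiPoly (2 * a) (n + 2)).eval x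
      = (2 * n + 3 + a) * ((2 * n + 4 + a) * (2 * n + 2 + a) * x + a ^ 2)
          * (jacobiPoly (2 * a) (n + 1)).eval x
        - 2 * (n + 1) ^ 2 * (2 * n + 4 + a) * (jacobiPoly (2 * a) n).eval x := by
  have h1 : (n + 2 + a) ≠ 0 := by positivity
  have h2 : (2 * n + 2 + a) ≠ 0 := by positivity
  have h3 : ((n : ℝ) + 1 + 1 + a) ≠ 0 := by positivity
  have h4 : (2 * ((n : ℝ) + 1) + a) ≠ 0 := by positivity
  simp only [jacobiPoly, jacobiA, jacobiB, jacobiC, Nat.succ_ne_zero, if_false, eval_sub, eval_add,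
    eval_mul, eval_C, eval_X]
  push_cast
  rw [mul_div_cancel_left₀ a two_ne_zero]
  field_simp
  ring

theorem eval_derivative_jacobiPoly_add_two {a : ℝ} (ha : 0 ≤ a) (n : ℕ) (x : ℝ) :
    2 * (n + 2 + a) ^ 2 * (2 * n + 2 + a) * (derivative (jacobiPoly (2 * a) (n + 2))).eval x
      = (2 * n + 3 + a) * ((2 * n + 4 + a) * (2 * n + 2 + a) * x + a ^ 2)
          * (derivative (jacobiPoly (2 * a) (n + 1))).eval x
        + (2 * n + 3 + a) * (2 * n + 4 + a) * (2 * n + 2 + a)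
          * (jacobiPoly (2 * a) (n + 1)).eval x
        - 2 * (n + 1) ^ 2 * (2 * n + 4 + a) * (derivative (jacobiPoly (2 * a) n)).eval x := by
  have h1 : (n + 2 + a) ≠ 0 := by positivity
  have h2 : (2 * n + 2 + a) ≠ 0 := by positivity
  have h3 : ((n : ℝ) + 1 + 1 + a) ≠ 0 := by positivity
  have h4 : (2 * ((n : ℝ) + 1) + a) ≠ 0 := by positivity
  simp only [jacobiPoly, jacobiA, jacobiB, jacobiC, Nat.succ_ne_zero, if_false, derivative_sub,
    derivative_mul, derivative_add, derivative_C, derivative_X, eval_sub, eval_add,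
    eval_mul, eval_C, eval_X, eval_zero, eval_one]
  push_cast
  rw [mul_div_cancel_left₀ a two_ne_zero]
  field_simp
  ring

theorem eval_one_jacobiPoly {a : ℝ} (ha : 0 ≤ a) (n : ℕ) :
    (jacobiPoly (2 * a) n).eval 1 = 1 := by
  induction n using Nat.twoStepInduction with
  | zero => simp [jacobiPoly]
  | one =>
    have h : (1 + a) ≠ 0 := by positivity
    rw [eval_jacobiPoly_one ha]
    field_simp
    ring
  | more n ih1 ih2 =>
    have h := eval_jacobiPoly_add_two ha n 1
    rw [ih1, ih2] at h
    have h0 : 2 * (n + 2 + a) ^ 2 * (2 * n + 2 + a) ≠ 0 := by positivity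
    apply mul_left_cancel₀ h0
    rw [h]
    ring

/-- The two structure relations, which express the derivative through the neighbours. -/
theorem jacobiPoly_structure {a : ℝ} (ha : 0 ≤ a) (n : ℕ) (x : ℝ) :
    (2 * n + 2 + a) * (1 - x ^ 2) * (derivative (jacobiPoly (2 * a) (n + 1))).eval x
        = (n + 1) * (a - (2 * n + 2 + a) * x) * (jacobiPoly (2 * a) (n + 1)).eval x
          + 2 * (n + 1) ^ 2 * (jacobiPoly (2 * a) n).eval x ∧
    (2 * n + 2 + a) * (1 - x ^ 2) * (derivative (jacobiPoly (2 * a) n)).eval x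
        = (n + 1 + a) * (a + (2 * n + 2 + a) * x) * (jacobiPoly (2 * a) n).eval x
          - 2 * (n + 1 + a) ^ 2 * (jacobiPoly (2 * a) (n + 1)).eval x := by
  induction n with
  | zero =>
    have h : (1 + a) ≠ 0 := by positivity
    simp only [zero_add, eval_jacobiPoly_one ha, eval_derivative_jacobiPoly_one ha]
    simp only [jacobiPoly, derivative_one, eval_zero, eval_one, Nat.cast_zero]
    constructor <;> (field_simp; ring)
  | succ n ih =>
    obtain ⟨hS, hT⟩ := ih
    have hR := eval_jacobiPoly_add_two ha n x
    have hD := eval_derivative_jacobiPoly_add_two ha n x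
    have hs0 : 0 < 2 * n + 2 + a := by positivity
    have hr0 : 0 < 2 * (n + 2 + a) ^ 2 * (2 * n + 2 + a) := by positivity
    push_cast
    rw [show n + 1 + 1 = n + 2 by rfl]
    generalize (jacobiPoly (2 * a) n).eval x = y0 at *
    generalize (jacobiPoly (2 * a) (n + 1)).eval x = y1 at *
    generalize (jacobiPoly (2 * a) (n + 2)).eval x = y2 at *
    generalize (derivative (jacobiPoly (2 * a) n)).eval x = z0 at *
    generalize (derivative (jacobiPoly (2 * a) (n + 1))).eval x = z1 at *
    generalize (derivative (jacobiPoly (2 * a) (n + 2))).eval x = z2 at *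
    generalize (n : ℝ) = m at *
    have hs : 2 * m + 2 + a ≠ 0 := hs0.ne'
    have hr : 2 * (m + 2 + a) ^ 2 * (2 * m + 2 + a) ≠ 0 := hr0.ne'
    -- The two relations must be carried together: the first at the next index uses the
    -- differentiated recurrence and both old relations to remove the derivatives; the second needs
    -- only the recurrence and the old first relation.
    constructor
    · apply mul_left_cancel₀ (mul_ne_zero hs hr)
      linear_combination (2 * m + 2 + a) * (2 * m + 4 + a) * (1 - x ^ 2) * hD
        + (2 * m + 4 + a) * (2 * m + 3 + a) * ((2 * m + 4 + a) * (2 * m + 2 + a) * x + a ^ 2) * hS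
        - (2 * m + 4 + a) * (2 * (m + 1) ^ 2 * (2 * m + 4 + a)) * hT
        - (2 * m + 2 + a) * (m + 2) * (a - (2 * m + 4 + a) * x) * hR
    · apply mul_left_cancel₀ hs
      linear_combination (2 * m + 4 + a) * hS + hR

/-- The Jacobi differential equation. -/
theorem jacobiPoly_ode {a : ℝ} (ha : 0 ≤ a) (n : ℕ) {x : ℝ} (hx : x ∈ Set.Ioo (-1 : ℝ) 1) :
    (1 - x ^ 2) * (derivative (derivative (jacobiPoly (2 * a) n))).eval x
      = (a + (a + 2) * x) * (derivative (jacobiPoly (2 * a) n)).eval x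
        - n * (n + a + 1) * (jacobiPoly (2 * a) n).eval x := by
  rcases n with _ | n
  · simp [jacobiPoly]
  obtain ⟨hS, hT⟩ := jacobiPoly_structure ha n x
  -- As a polynomial identity the first relation can be differentiated; the second relation then
  -- removes the derivative of the lower-degree neighbour.
  have hpoly : C (2 * n + 2 + a) * (1 - X ^ 2) * derivative (jacobiPoly (2 * a) (n + 1))
      = C (n + 1 : ℝ) * (C a - C (2 * n + 2 + a) * X) * jacobiPoly (2 * a) (n + 1)
        + C (2 * (n + 1) ^ 2 : ℝ) * jacobiPoly (2 * a) n := by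
    refine Polynomial.funext fun r => ?_
    simp only [eval_add, eval_mul, eval_sub, eval_C, eval_X, eval_pow, eval_one]
    exact (jacobiPoly_structure ha n r).1
  have hD := congrArg (fun q => (derivative q).eval x) hpoly
  simp only [derivative_mul, derivative_add, derivative_sub, derivative_C, derivative_X,
    derivative_X_pow, derivative_one, eval_add, eval_mul, eval_sub, eval_C, eval_X, eval_pow,
    eval_one, eval_zero] at hD
  have hs : 2 * n + 2 + a ≠ 0 := by positivity
  have h1 : 1 - x ^ 2 ≠ 0 := by nlinarith [hx.1, hx.2]
  push_cast at hD ⊢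
  generalize (jacobiPoly (2 * a) n).eval x = y0 at *
  generalize (jacobiPoly (2 * a) (n + 1)).eval x = y1 at *
  generalize (derivative (jacobiPoly (2 * a) n)).eval x = z0 at *
  generalize (derivative (derivative (jacobiPoly (2 * a) (n + 1)))).eval x = w1 at *
  generalize (derivative (jacobiPoly (2 * a) (n + 1))).eval x = z1 at *
  generalize (n : ℝ) = m at *
  apply mul_left_cancel₀ (mul_ne_zero (pow_ne_zero 2 hs) h1)
  linear_combination (2 * m + 2 + a) * (1 - x ^ 2) * hD + 2 * (m + 1) ^ 2 * hT
    - (m + 1 + a) * (a + (2 * m + 2 + a) * x) * hS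

/-! ### Pointwise bounds by Sonin energies. -/

/-- By the differential equation, the left side has derivative 2 (a + (a + 1) x) p'² / N ≥ 0 with N
= n (n + a + 1), so it increases to its value 1 at x = 1. -/
theorem jacobiPoly_sq_add_deriv_sq_le {a : ℝ} (ha : 0 ≤ a) {n : ℕ} (hn : n ≠ 0) {x : ℝ}
    (hx : x ∈ Set.Icc (0 : ℝ) 1) :
    (jacobiPoly (2 * a) n).eval x ^ 2
      + (1 - x ^ 2) * (derivative (jacobiPoly (2 * a) n)).eval x ^ 2 / (n * (n + a + 1)) ≤ 1 := by
  set p := jacobiPoly (2 * a) n with hp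
  have hN : 0 < n * (n + a + 1) := by
    have : (0 : ℝ) < n := by exact_mod_cast Nat.pos_of_ne_zero hn
    positivity
  set N := n * (n + a + 1) with hNdef
  have hder : ∀ r ∈ Set.Ioo (0 : ℝ) 1,
      HasDerivAt (fun r => p.eval r ^ 2 + (1 - r ^ 2) * (derivative p).eval r ^ 2 / N)
        (2 * (a + (a + 1) * r) * (derivative p).eval r ^ 2 / N) r := by
    intro r hr
    have hode := jacobiPoly_ode ha n (x := r) ⟨by linarith [hr.1], hr.2⟩
    rw [← hp, ← hNdef] at hode
    have h := ((p.hasDerivAt r).pow 2).add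
      ((((hasDerivAt_pow 2 r).const_sub 1).mul (((derivative p).hasDerivAt r).pow 2)).div_const N)
    refine h.congr_deriv ?_
    simp only [Pi.pow_apply]
    rw [← sub_eq_zero]
    rw [← sub_eq_zero] at hode
    trans 2 * (derivative p).eval r / N * ((1 - r ^ 2) * (derivative (derivative p)).eval r
      - ((a + (a + 2) * r) * (derivative p).eval r - N * p.eval r))
    · clear_value N
      push_cast
      field_simp
      ring
    · rw [hode, mul_zero]
  have hmono : MonotoneOn (fun r => p.eval r ^ 2 + (1 - r ^ 2) * (derivative p).eval r ^ 2 / N)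
      (Set.Icc 0 1) := by
    refine monotoneOn_of_deriv_nonneg (convex_Icc 0 1) ?_ ?_ ?_
    · exact Continuous.continuousOn (by fun_prop)
    · rw [interior_Icc]
      exact fun r hr => (hder r hr).differentiableAt.differentiableWithinAt
    · rw [interior_Icc]
      intro r hr
      rw [(hder r hr).deriv]
      have := hr.1
      positivity
  have h := hmono hx (Set.right_mem_Icc.mpr zero_le_one) hx.2
  simpa [hp, eval_one_jacobiPoly ha] using h

/-- The energy of `(1 - x) ^ (a / 2) * p x`, for the Jacobi polynomial `p` of degree `n`. -/
noncomputable def jacobiEnergy (a : ℝ) (n : ℕ) (x : ℝ) : ℝ :=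
  (1 - x) ^ a * ((jacobiPoly (2 * a) n).eval x ^ 2
    + (1 + x) * (2 * (1 - x) * (derivative (jacobiPoly (2 * a) n)).eval x
        - a * (jacobiPoly (2 * a) n).eval x) ^ 2
      / (2 * (2 * ((n + a / 2) * (n + a / 2 + 1)) * (1 - x) - a ^ 2)))

/-- Put M = (n + a/2)(n + a/2 + 1) and u = (1 - x)^(a/2) p. Then ((1 - x²) u')' + Q u = 0 with Q = M
- a² / (2 (1 - x)), and the energy is u² + (1 - x²) u'² / Q. Its derivative is -((1 - x²) Q)' u'² /
Q², and -((1 - x²) Q)' = 2 M x + a² / 2. The hypothesis `hD` says Q > 0. -/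
theorem hasDerivAt_jacobiEnergy {a : ℝ} (ha : 0 ≤ a) (n : ℕ) {x : ℝ}
    (hx : x ∈ Set.Ioo (-1 : ℝ) 1)
    (hD : 0 < 2 * ((n + a / 2) * (n + a / 2 + 1)) * (1 - x) - a ^ 2) :
    HasDerivAt (jacobiEnergy a n)
      ((1 - x) ^ a * ((2 * ((n + a / 2) * (n + a / 2 + 1)) * x + a ^ 2 / 2)
        * (2 * (1 - x) * (derivative (jacobiPoly (2 * a) n)).eval x
          - a * (jacobiPoly (2 * a) n).eval x) ^ 2
        / (2 * ((n + a / 2) * (n + a / 2 + 1)) * (1 - x) - a ^ 2) ^ 2)) x := by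
  have hode := jacobiPoly_ode ha n hx
  unfold jacobiEnergy
  set p := jacobiPoly (2 * a) n with hp
  set M := (n + a / 2) * (n + a / 2 + 1) with hM
  have hN : n * (n + a + 1) = M - a / 2 * (a / 2 + 1) := by rw [hM]; ring
  rw [hN] at hode
  have hx1 : 0 < 1 - x := by linarith [hx.2]
  have h1 : HasDerivAt (fun r : ℝ => 1 - r) (-1) x := (hasDerivAt_id x).const_sub 1
  have h2 : HasDerivAt (fun r : ℝ => 1 + r) 1 x := (hasDerivAt_id x).const_add 1
  have hg := ((h1.const_mul 2).mul ((derivative p).hasDerivAt x)).sub ((p.hasDerivAt x).const_mul a)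
  have hden := ((h1.const_mul (2 * M)).sub_const (a ^ 2)).const_mul 2
  have h := (h1.rpow_const (p := a) (Or.inl hx1.ne')).mul
    (((p.hasDerivAt x).pow 2).add ((h2.mul (hg.pow 2)).div hden
      (mul_ne_zero two_ne_zero hD.ne')))
  refine h.congr_deriv ?_
  simp only [Pi.pow_apply, Pi.mul_apply, Pi.sub_apply, Pi.add_apply, Pi.div_apply]
  rw [Real.rpow_sub_one hx1.ne']
  generalize (1 - x) ^ a = E at *
  have hx2 := hx1.ne'
  have hD' := hD.ne'
  generalize (derivative (derivative p)).eval x = w at *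
  generalize (derivative p).eval x = z at *
  generalize p.eval x = y at *
  rw [← sub_eq_zero]
  rw [← sub_eq_zero] at hode
  trans E * 2 * (2 * (1 - x) * z - a * y) / (2 * M * (1 - x) - a ^ 2)
    * ((1 - x ^ 2) * w - ((a + (a + 2) * x) * z - (M - a / 2 * (a / 2 + 1)) * y))
  · clear_value M
    clear hode
    generalize hDe : 2 * M * (1 - x) - a ^ 2 = D at *
    push_cast
    field_simp
    rw [← hDe]
    ring
  · rw [hode, mul_zero]

/-- Both sides are compared with exp (-a / s). The right side telescopes over s, s + 1, ..., which
gives the decay at x = -1. -/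
theorem one_sub_div_le_rpow {a s : ℝ} (ha : 0 ≤ a) (hs : 0 < s) :
    1 - a / s ≤ (s / (s + 1)) ^ a := by
  have h1 : Real.exp (-(1 / s)) ≤ s / (s + 1) := by
    rw [Real.exp_neg, inv_le_comm₀ (Real.exp_pos _) (by positivity), inv_div, add_div,
      div_self hs.ne', add_comm]
    exact Real.add_one_le_exp _
  calc 1 - a / s ≤ Real.exp (-(a / s)) := by linarith [Real.add_one_le_exp (-(a / s))]
    _ = Real.exp (-(1 / s)) ^ a := by rw [← Real.exp_mul]; congr 1; ring
    _ ≤ _ := Real.rpow_le_rpow (Real.exp_pos _).le h1 ha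

/-- At x = -1 the second structure relation loses its derivative and becomes a two-term recurrence.
-/
theorem abs_jacobiPoly_eval_neg_one_le {a : ℝ} (ha : 0 ≤ a) (n : ℕ) :
    |(jacobiPoly (2 * a) n).eval (-1)| ≤ ((1 + a) / (n + 1 + a)) ^ a := by
  induction n with
  | zero =>
    have h : (1 + a) ≠ 0 := by positivity
    simp [jacobiPoly, h]
  | succ n ih =>
    have h := (jacobiPoly_structure ha n (-1)).2
    have hs : 0 < n + 1 + a := by positivity
    have hrec : (jacobiPoly (2 * a) (n + 1)).eval (-1)
        = -((1 - a / (n + 1 + a)) * (jacobiPoly (2 * a) n).eval (-1)) := by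
      field_simp
      apply mul_left_cancel₀ hs.ne'
      linear_combination (1 / 2) * h
    have hnn : 0 ≤ 1 - a / (n + 1 + a) := by
      rw [sub_nonneg, div_le_one hs]
      linarith [(Nat.cast_nonneg n : (0 : ℝ) ≤ n)]
    rw [hrec, abs_neg, abs_mul, abs_of_nonneg hnn]
    calc (1 - a / (n + 1 + a)) * |(jacobiPoly (2 * a) n).eval (-1)|
        ≤ ((n + 1 + a) / (n + 1 + a + 1)) ^ a * ((1 + a) / (n + 1 + a)) ^ a :=
          mul_le_mul (one_sub_div_le_rpow ha hs) ih (abs_nonneg _) (by positivity)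
      _ = ((1 + a) / ((n + 1 : ℕ) + 1 + a)) ^ a := by
          rw [← Real.mul_rpow (by positivity) (by positivity)]
          congr 1
          push_cast
          field_simp
          ring

theorem jacobiEnergy_le {a : ℝ} (ha : 0 ≤ a) (n : ℕ) {b x : ℝ} (hb0 : 0 ≤ b) (hb1 : b < 1)
    (hD : 0 < 2 * ((n + a / 2) * (n + a / 2 + 1)) * (1 - b) - a ^ 2)
    (hx : x ∈ Set.Icc (-1) b) :
    jacobiEnergy a n x ≤ max (jacobiEnergy a n (-1)) (jacobiEnergy a n b) := by
  set M := (n + a / 2) * (n + a / 2 + 1) with hM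
  have hM0 : 0 < M := by
    have : 0 ≤ M := by positivity
    refine this.lt_of_ne' fun h => ?_
    rw [h] at hD
    nlinarith
  have hDr : ∀ r ≤ b, 0 < 2 * M * (1 - r) - a ^ 2 := fun r hr => by nlinarith
  have hcont : ContinuousOn (jacobiEnergy a n) (Set.Icc (-1) b) := by
    intro r hr
    have h1 : 1 - r ≠ 0 := by linarith [hr.2]
    have h2 : 2 * (2 * ((n + a / 2) * (n + a / 2 + 1)) * (1 - r) - a ^ 2) ≠ 0 :=
      (mul_pos two_pos (hDr r hr.2)).ne'
    refine ContinuousAt.continuousWithinAt ?_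
    unfold jacobiEnergy
    refine ContinuousAt.mul (ContinuousAt.rpow_const (by fun_prop) (Or.inl h1)) ?_
    exact ContinuousAt.add (by fun_prop) (ContinuousAt.div (by fun_prop) (by fun_prop) h2)
  have hder : ∀ r ∈ Set.Ioo (-1) b, HasDerivAt (jacobiEnergy a n) _ r := fun r hr =>
    hasDerivAt_jacobiEnergy ha n ⟨hr.1, hr.2.trans hb1⟩ (hDr r hr.2.le)
  -- The zero of 2 M x + a² / 2: the energy decreases before c and increases after it, so its
  -- maximum is at an endpoint.
  set c := -(a ^ 2 / (4 * M)) with hc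
  have hc0 : c ≤ 0 := by rw [hc]; simp only [Left.neg_nonpos_iff]; positivity
  have hc1 : -1 ≤ c := by
    rw [hc, neg_le_neg_iff, div_le_one (by positivity)]
    nlinarith
  have hcM : 2 * M * c + a ^ 2 / 2 = 0 := by
    rw [hc]; field_simp; ring
  rcases le_total x c with hxc | hxc
  · refine le_max_of_le_left ?_
    have hanti : AntitoneOn (jacobiEnergy a n) (Set.Icc (-1) c) := by
      refine antitoneOn_of_deriv_nonpos (convex_Icc _ _)
        (hcont.mono (Set.Icc_subset_Icc_right (hc0.trans hb0))) ?_ ?_ <;> rw [interior_Icc]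
      · exact fun r hr => (hder r ⟨hr.1, hr.2.trans_le (hc0.trans hb0)⟩).differentiableAt
          |>.differentiableWithinAt
      · intro r hr
        rw [(hder r ⟨hr.1, hr.2.trans_le (hc0.trans hb0)⟩).deriv]
        refine mul_nonpos_of_nonneg_of_nonpos (Real.rpow_nonneg ?_ _)
          (div_nonpos_of_nonpos_of_nonneg (mul_nonpos_of_nonpos_of_nonneg ?_ (sq_nonneg _))
            (sq_nonneg _))
        · linarith [hr.2]
        · have := hr.2
          nlinarith
    exact hanti ⟨le_rfl, hc1⟩ ⟨hx.1, hxc⟩ hx.1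
  · refine le_max_of_le_right ?_
    have hmono : MonotoneOn (jacobiEnergy a n) (Set.Icc c b) := by
      refine monotoneOn_of_deriv_nonneg (convex_Icc _ _)
        (hcont.mono (Set.Icc_subset_Icc_left hc1)) ?_ ?_ <;> rw [interior_Icc]
      · exact fun r hr => (hder r ⟨hc1.trans_lt hr.1, hr.2⟩).differentiableAt
          |>.differentiableWithinAt
      · intro r hr
        rw [(hder r ⟨hc1.trans_lt hr.1, hr.2⟩).deriv]
        refine mul_nonneg (Real.rpow_nonneg ?_ _)
          (div_nonneg (mul_nonneg ?_ (sq_nonneg _)) (sq_nonneg _))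
        · linarith [hr.2]
        · have := hr.1
          nlinarith
    exact hmono ⟨hxc, hx.2⟩ ⟨hc0.trans hb0, le_rfl⟩ hx.2

theorem jacobiPoly_sq_le_one {a : ℝ} (ha : 0 ≤ a) (n : ℕ) {x : ℝ} (hx : x ∈ Set.Icc (0 : ℝ) 1) :
    (jacobiPoly (2 * a) n).eval x ^ 2 ≤ 1 := by
  rcases eq_or_ne n 0 with rfl | hn
  · simp [jacobiPoly]
  · refine le_trans ?_ (jacobiPoly_sq_add_deriv_sq_le ha hn hx)
    have : 0 ≤ 1 - x ^ 2 := by nlinarith [hx.1, hx.2]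
    exact le_add_of_nonneg_right (by positivity)

/-- A weighted pointwise bound for the normalized Jacobi polynomials. -/
theorem exists_rpow_mul_jacobiPoly_sq_le {a : ℝ} (ha : 0 ≤ a) :
    ∃ K : ℝ, 1 ≤ K ∧ ∀ n : ℕ, a + 1 ≤ n → ∀ x ∈ Set.Icc (-1 : ℝ) 1,
      (1 - x) ^ a * (jacobiPoly (2 * a) n).eval x ^ 2 ≤ K * ((n : ℝ) ^ 2) ^ (-a) := by
  -- The first constant covers x ≥ 1 - s and the energy at 1 - s, where 7 = 1 + 6 bounds its two
  -- terms; the second covers the energy at -1.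
  refine ⟨max (7 * (a ^ 2 + 1) ^ a) (2 ^ a * ((1 + a) ^ 2) ^ a), ?_, fun n hn x hx => ?_⟩
  · refine le_max_of_le_left ?_
    have : (1 : ℝ) ≤ (a ^ 2 + 1) ^ a := Real.one_le_rpow (by nlinarith) ha
    linarith
  have hn0 : 0 < (n : ℝ) := by linarith
  have hnn : n ≠ 0 := by rintro rfl; simp at hn0
  set M := (n + a / 2) * (n + a / 2 + 1) with hM
  have hMn : (n : ℝ) ^ 2 ≤ M := by rw [hM]; nlinarith
  have hMa : a ^ 2 + 1 ≤ M := by nlinarith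
  have hM0 : 0 < M := by nlinarith
  -- Of order n⁻², and large enough that the energy denominator 2 M s - a² = a² + 2 is bounded
  -- below.
  set s := (a ^ 2 + 1) / M with hs
  have hs0 : 0 < s := by positivity
  have hs1 : s ≤ 1 := (div_le_one hM0).mpr hMa
  have hsM : M * s = a ^ 2 + 1 := by rw [hs]; field_simp
  have hsa : s ^ a ≤ (a ^ 2 + 1) ^ a * ((n : ℝ) ^ 2) ^ (-a) := by
    rw [Real.rpow_neg (by positivity), ← div_eq_mul_inv, ← Real.div_rpow (by positivity)
      (by positivity)]
    refine Real.rpow_le_rpow hs0.le ?_ ha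
    rw [hs]
    gcongr
  have hsa0 : 0 ≤ s ^ a := Real.rpow_nonneg hs0.le _
  have hn2 : 0 ≤ ((n : ℝ) ^ 2) ^ (-a) := by positivity
  rcases le_total (1 - s) x with hxs | hxs
  · calc (1 - x) ^ a * (jacobiPoly (2 * a) n).eval x ^ 2 ≤ s ^ a * 1 :=
          mul_le_mul (Real.rpow_le_rpow (by linarith [hx.2]) (by linarith) ha)
            (jacobiPoly_sq_le_one ha n ⟨by linarith, hx.2⟩) (sq_nonneg _) hsa0
      _ ≤ 7 * (a ^ 2 + 1) ^ a * ((n : ℝ) ^ 2) ^ (-a) := by linarith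
      _ ≤ _ := mul_le_mul_of_nonneg_right (le_max_left _ _) hn2
  · have hD : 2 * M * (1 - (1 - s)) - a ^ 2 = a ^ 2 + 2 := by linear_combination 2 * hsM
    have hE := jacobiEnergy_le ha n (b := 1 - s) (x := x) (by linarith) (by linarith)
      (by rw [← hM, hD]; positivity) ⟨hx.1, hxs⟩
    have hlow : (1 - x) ^ a * (jacobiPoly (2 * a) n).eval x ^ 2 ≤ jacobiEnergy a n x := by
      unfold jacobiEnergy
      rw [← hM]
      have h1 : 0 ≤ 1 - x := by linarith [hx.2]
      have h2 : 0 ≤ 1 + x := by linarith [hx.1]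
      have h3 : 0 < 2 * M * (1 - x) - a ^ 2 := by nlinarith
      exact mul_le_mul_of_nonneg_left (le_add_of_nonneg_right (by positivity))
        (Real.rpow_nonneg h1 _)
    refine hlow.trans (hE.trans ?_)
    rw [max_mul_of_nonneg _ _ hn2, max_comm]
    refine max_le_max ?_ ?_
    · unfold jacobiEnergy
      rw [← hM, hD, sub_sub_cancel]
      have hf := jacobiPoly_sq_add_deriv_sq_le ha hnn (x := 1 - s) ⟨by linarith, by linarith⟩
      generalize (derivative (jacobiPoly (2 * a) n)).eval (1 - s) = z at *
      generalize (jacobiPoly (2 * a) n).eval (1 - s) = y at *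
      have hN : 0 < n * (n + a + 1) := by positivity
      have hNM : n * (n + a + 1) ≤ M := by rw [hM]; nlinarith
      have h12 : 1 - (1 - s) ^ 2 = s * (2 - s) := by ring
      rw [h12] at hf
      have hy : y ^ 2 ≤ 1 := by
        refine le_trans (le_add_of_nonneg_right ?_) hf
        have : 0 ≤ 2 - s := by linarith
        positivity
      have hz : s * (2 - s) * z ^ 2 ≤ M := by
        have : s * (2 - s) * z ^ 2 / (n * (n + a + 1)) ≤ 1 := by linarith [sq_nonneg y]
        rw [div_le_one hN] at this
        linarith
      have hg : (1 + (1 - s)) * (2 * s * z - a * y) ^ 2 ≤ 12 * a ^ 2 + 8 := by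
        have h1 : (2 * s * z - a * y) ^ 2 ≤ 2 * (4 * s ^ 2 * z ^ 2 + a ^ 2 * y ^ 2) := by
          nlinarith [sq_nonneg (2 * s * z + a * y)]
        have h2 : (2 - s) * (2 * s * z - a * y) ^ 2
            ≤ (2 - s) * (2 * (4 * s ^ 2 * z ^ 2 + a ^ 2 * y ^ 2)) :=
          mul_le_mul_of_nonneg_left h1 (by linarith)
        have h3 : s * (s * (2 - s) * z ^ 2) ≤ s * M := mul_le_mul_of_nonneg_left hz hs0.le
        have h4 : a ^ 2 * y ^ 2 ≤ a ^ 2 := mul_le_of_le_one_right (sq_nonneg a) hy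
        have h5 : 0 ≤ s * (a ^ 2 * y ^ 2) := by positivity
        linarith
      have hq : y ^ 2 + (1 + (1 - s)) * (2 * s * z - a * y) ^ 2 / (2 * (a ^ 2 + 2)) ≤ 7 := by
        have : (1 + (1 - s)) * (2 * s * z - a * y) ^ 2 / (2 * (a ^ 2 + 2)) ≤ 6 := by
          rw [div_le_iff₀ (by positivity)]
          linarith [sq_nonneg a]
        linarith
      calc s ^ a * _ ≤ s ^ a * 7 := mul_le_mul_of_nonneg_left hq hsa0
        _ ≤ _ := by linarith
    · have h := abs_jacobiPoly_eval_neg_one_le ha n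
      have h1 : jacobiEnergy a n (-1) = 2 ^ a * |(jacobiPoly (2 * a) n).eval (-1)| ^ 2 := by
        unfold jacobiEnergy
        rw [sq_abs]
        norm_num
      rw [h1, mul_assoc]
      refine mul_le_mul_of_nonneg_left ?_ (by positivity)
      calc |(jacobiPoly (2 * a) n).eval (-1)| ^ 2 ≤ (((1 + a) / (n + 1 + a)) ^ a) ^ 2 := by gcongr
        _ = (((1 + a) / (n + 1 + a)) ^ 2) ^ a := by
            rw [← Real.rpow_natCast, ← Real.rpow_natCast, ← Real.rpow_mul (by positivity),
              ← Real.rpow_mul (by positivity), mul_comm]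
        _ ≤ ((1 + a) ^ 2 / (n : ℝ) ^ 2) ^ a := by
            rw [← div_pow]
            gcongr
            linarith
        _ = _ := by
            rw [Real.rpow_neg (by positivity), ← div_eq_mul_inv, ← Real.div_rpow (by positivity)
              (by positivity)]

/-! ### Shift-register polynomials near 1. -/

theorem eval_one_shiftPoly (ω : ℝ) (t : ℕ) : (shiftPoly ω t).eval 1 = 1 := by
  induction t using Nat.twoStepInduction with
  | zero => simp [shiftPoly]
  | one => simp [shiftPoly]
  | more t ih1 ih2 => simp [shiftPoly, ih1, ih2]

/-- The number 1 - K s lies between the roots of the characteristic polynomial r² - ω (1 - s) r + (ω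
- 1), so a ratio of consecutive values at least 1 - K s stays so. -/
theorem pow_le_eval_shiftPoly {ω K s : ℝ} (hω : ω ∈ Set.Ico (1 : ℝ) 2) (hK : K * (2 - ω) = 4)
    (hs : 0 ≤ s) (hKs : K ^ 2 * s ≤ 1) (t : ℕ) :
    (1 - K * s) ^ t ≤ (shiftPoly ω t).eval (1 - s) := by
  obtain ⟨hω1, hω2⟩ := hω
  have hK4 : 4 ≤ K := by nlinarith
  have hr : 0 < 1 - K * s := by nlinarith
  have hq : (1 - K * s) ^ 2 - ω * (1 - s) * (1 - K * s) + (ω - 1) ≤ 0 := by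
    have h : (1 - K * s) ^ 2 - ω * (1 - s) * (1 - K * s) + (ω - 1)
        = s * (ω - K * (2 - ω) + K ^ 2 * s - ω * (K * s)) := by ring
    rw [h, hK]
    refine mul_nonpos_of_nonneg_of_nonpos hs ?_
    have : 0 ≤ ω * (K * s) := by positivity
    linarith
  have key : ∀ t, 0 < (shiftPoly ω t).eval (1 - s) ∧
      (1 - K * s) * (shiftPoly ω t).eval (1 - s) ≤ (shiftPoly ω (t + 1)).eval (1 - s) := by
    intro t
    induction t with
    | zero =>
      refine ⟨by simp [shiftPoly], ?_⟩
      simp only [shiftPoly, eval_one, eval_X]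
      nlinarith
    | succ t ih =>
      have hpos : 0 < (shiftPoly ω (t + 1)).eval (1 - s) := (mul_pos hr ih.1).trans_le ih.2
      refine ⟨hpos, ?_⟩
      have hrec : (shiftPoly ω (t + 1 + 1)).eval (1 - s)
          = ω * (1 - s) * (shiftPoly ω (t + 1)).eval (1 - s)
            + (1 - ω) * (shiftPoly ω t).eval (1 - s) := by
        simp [shiftPoly]
      rw [hrec]
      have h1 := mul_le_mul_of_nonneg_left ih.2 (sub_nonneg.mpr hω1)
      have h2 := mul_nonneg_of_nonpos_of_nonpos hq (neg_nonpos.mpr hpos.le)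
      refine le_of_mul_le_mul_left ?_ hr
      nlinarith
  induction t with
  | zero => simp [shiftPoly]
  | succ t ih =>
    rw [pow_succ']
    exact (mul_le_mul_of_nonneg_left ih hr.le).trans (key t).2

/-! ### Row norms compared with return probabilities. -/

open Classical in
/-- The squared `ℓ²` norm of the row `v` of the matrix `p(W)`. -/
noncomputable def IsGossipMatrix.rowNormSq (hW : IsGossipMatrix G W) (v : V) (p : ℝ[X]) : ℝ :=
  aeval hW.toLin (p ^ 2) (Pi.single v 1) v

theorem IsGossipMatrix.exists_row (hW : IsGossipMatrix G W) (v : V) (p : ℝ[X]) :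
    ∃ (B : Finset V) (c : B → ℝ), (∀ x : V → ℝ, aeval hW.toLin p x v = ∑ w, c w * x w) ∧
      ∑ w, c w ^ 2 = hW.rowNormSq v p ∧ ∑ w, c w = p.eval 1 := by
  -- Twice the degree, so that one spectral measure serves both p and p².
  obtain ⟨B, wt, node, -, -, -, h⟩ := hW.exists_spectral_measure v (2 * p.natDegree)
  obtain ⟨-, c, hc, hc2⟩ := h p (by omega)
  refine ⟨B, c, hc, ?_, ?_⟩
  · rw [IsGossipMatrix.rowNormSq, (h (p ^ 2) natDegree_pow_le).1, hc2]
    simp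
  · have h1 := hc 1
    rw [hW.aeval_toLin_one] at h1
    simpa using h1.symm

/-- A pointwise bound of `p ^ 2` by return polynomials gives a bound of the row norm. -/
theorem IsGossipMatrix.rowNormSq_le (hW : IsGossipMatrix G W) (v : V) (p : ℝ[X]) {ι : Type*}
    (S : Finset ι) (T : ι → ℕ) (b : ι → ℝ) (b₀ : ℝ)
    (h : ∀ x ∈ Set.Icc (-1 : ℝ) 1, p.eval x ^ 2 ≤ b₀ + ∑ j ∈ S, b j * ((1 + x) / 2) ^ T j) :
    hW.rowNormSq v p ≤ b₀ + ∑ j ∈ S, b j * returnProb hW v (T j) := by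
  obtain ⟨B, wt, node, hwt, hnode, hsum, hp⟩ :=
    hW.exists_spectral_measure v (2 * p.natDegree + ∑ j ∈ S, T j)
  have hT : ∀ j ∈ S, returnProb hW v (T j) = ∑ i, wt i * ((1 + node i) / 2) ^ T j := by
    intro j hj
    have hTj : T j ≤ ∑ j ∈ S, T j := Finset.single_le_sum (fun _ _ => Nat.zero_le _) hj
    rw [hW.returnProb_eq, (hp _ ((natDegree_lazyPoly_pow_le (T j)).trans (by omega))).1]
    refine Finset.sum_congr rfl fun i _ => ?_
    simp only [lazyPoly, eval_pow, eval_mul, eval_C, eval_add, eval_one, eval_X]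
    ring_nf
  rw [IsGossipMatrix.rowNormSq, (hp (p ^ 2) (natDegree_pow_le.trans (by omega))).1]
  calc ∑ i, wt i * (p ^ 2).eval (node i)
      ≤ ∑ i, wt i * (b₀ + ∑ j ∈ S, b j * ((1 + node i) / 2) ^ T j) := by
        refine Finset.sum_le_sum fun i _ => mul_le_mul_of_nonneg_left ?_ (hwt i)
        rw [eval_pow]
        exact h _ (abs_le.mp (hnode i))
    _ = b₀ + ∑ j ∈ S, b j * returnProb hW v (T j) := by
        simp only [mul_add, Finset.sum_add_distrib, ← Finset.sum_mul, hsum, one_mul]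
        congr 1
        simp only [Finset.mul_sum]
        rw [Finset.sum_comm]
        refine Finset.sum_congr rfl fun j hj => ?_
        rw [hT j hj, Finset.mul_sum]
        exact Finset.sum_congr rfl fun i _ => by ring

theorem IsGossipMatrix.returnProb_le_rowNormSq (hW : IsGossipMatrix G W) (v : V) (p : ℝ[X])
    (T : ℕ) (b b₀ : ℝ)
    (h : ∀ x ∈ Set.Icc (-1 : ℝ) 1, ((1 + x) / 2) ^ T ≤ b₀ + b * p.eval x ^ 2) :
    returnProb hW v T ≤ b₀ + b * hW.rowNormSq v p := by
  obtain ⟨B, wt, node, hwt, hnode, hsum, hp⟩ :=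
    hW.exists_spectral_measure v (2 * p.natDegree + T)
  rw [hW.returnProb_eq, (hp _ ((natDegree_lazyPoly_pow_le T).trans (by omega))).1,
    IsGossipMatrix.rowNormSq, (hp (p ^ 2) (natDegree_pow_le.trans (by omega))).1]
  calc ∑ i, wt i * (lazyPoly ^ T).eval (node i)
      ≤ ∑ i, wt i * (b₀ + b * p.eval (node i) ^ 2) := by
        refine Finset.sum_le_sum fun i _ => mul_le_mul_of_nonneg_left ?_ (hwt i)
        refine le_of_eq_of_le ?_ (h _ (abs_le.mp (hnode i)))
        simp only [lazyPoly, eval_pow, eval_mul, eval_C, eval_add, eval_one, eval_X]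
        ring_nf
    _ = b₀ + b * ∑ i, wt i * (p ^ 2).eval (node i) := by
        simp only [mul_add, Finset.sum_add_distrib, ← Finset.sum_mul, hsum, one_mul, eval_pow]
        rw [Finset.mul_sum]
        congr 1
        exact Finset.sum_congr rfl fun i _ => by ring

/-! ### From the spectral dimension to power bounds on row norms. -/

theorem HasSpectralDimension.nonneg {hW : IsGossipMatrix G W} {v : V} {ds : ℝ}
    (hds : HasSpectralDimension hW v ds) : 0 ≤ ds := by
  refine ge_of_tendsto' hds fun t => ?_
  have h1 : Real.log (returnProb hW v t) ≤ 0 :=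
    Real.log_nonpos (hW.returnProb_pos v t).le (hW.returnProb_le_one v t)
  have h2 : Real.log (returnProb hW v t) / Real.log t ≤ 0 :=
    div_nonpos_of_nonpos_of_nonneg h1 (Real.log_natCast_nonneg t)
  linarith

theorem HasSpectralDimension.eventually_le_returnProb {hW : IsGossipMatrix G W} {v : V} {ds : ℝ}
    (hds : HasSpectralDimension hW v ds) {r : ℝ} (hr : ds / 2 < r) :
    ∀ᶠ t : ℕ in atTop, (t : ℝ) ^ (-r) ≤ returnProb hW v t := by
  filter_upwards [hds.eventually_lt_const (show ds < 2 * r by linarith), eventually_ge_atTop 2]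
    with t ht ht2
  have ht1 : (1 : ℝ) < t := by exact_mod_cast ht2
  have hlog : 0 < Real.log t := Real.log_pos ht1
  have h : -r < Real.log (returnProb hW v t) / Real.log t := by linarith
  rw [lt_div_iff₀ hlog] at h
  rw [← Real.log_le_log_iff (by positivity) (hW.returnProb_pos v t), Real.log_rpow (by positivity)]
  exact h.le

theorem HasSpectralDimension.eventually_returnProb_le {hW : IsGossipMatrix G W} {v : V} {ds : ℝ}
    (hds : HasSpectralDimension hW v ds) {r : ℝ} (hr : r < ds / 2) :
    ∀ᶠ t : ℕ in atTop, returnProb hW v t ≤ (t : ℝ) ^ (-r) := by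
  filter_upwards [hds.eventually_const_lt (show 2 * r < ds by linarith), eventually_ge_atTop 2]
    with t ht ht2
  have ht1 : (1 : ℝ) < t := by exact_mod_cast ht2
  have hlog : 0 < Real.log t := Real.log_pos ht1
  have h : Real.log (returnProb hW v t) / Real.log t < -r := by linarith
  rw [div_lt_iff₀ hlog] at h
  rw [← Real.log_le_log_iff (hW.returnProb_pos v t) (by positivity), Real.log_rpow (by positivity)]
  exact h.le

/-- The dyadic sum also involves small times; they are absorbed in the constant. The exponent r may
be negative, whence |r|. -/
theorem HasSpectralDimension.exists_returnProb_le {hW : IsGossipMatrix G W} {v : V} {ds : ℝ}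
    (hds : HasSpectralDimension hW v ds) {r : ℝ} (hr : r < ds / 2) :
    ∃ K : ℝ, 0 < K ∧ ∀ t : ℕ, 1 ≤ t → returnProb hW v t ≤ K * (t : ℝ) ^ (-r) := by
  obtain ⟨t₀, ht₀⟩ := eventually_atTop.mp (hds.eventually_returnProb_le hr)
  refine ⟨max 1 (((t₀ : ℝ) + 1) ^ |r|), by positivity, fun t ht => ?_⟩
  have htpos : (1 : ℝ) ≤ t := by exact_mod_cast ht
  rcases le_total t₀ t with h | h
  · exact (ht₀ t h).trans (le_mul_of_one_le_left (by positivity) (le_max_left _ _))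
  · refine (hW.returnProb_le_one v t).trans ?_
    calc (1 : ℝ) = (t : ℝ) ^ r * (t : ℝ) ^ (-r) := by
          rw [← Real.rpow_add (by positivity), add_neg_cancel, Real.rpow_zero]
      _ ≤ _ := by
          refine mul_le_mul_of_nonneg_right (le_max_of_le_right ?_) (by positivity)
          calc (t : ℝ) ^ r ≤ (t : ℝ) ^ |r| := Real.rpow_le_rpow_of_exponent_le htpos (le_abs_self r)
            _ ≤ _ := by
              refine Real.rpow_le_rpow (by positivity) ?_ (abs_nonneg r)
              have : (t : ℝ) ≤ t₀ := by exact_mod_cast h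
              linarith

/-- If 1 - x ≤ 1 / (2 K t), Bernoulli makes the polynomial at least 1/2, so the last term is at
least 1. Otherwise (1 + x) / 2 ≤ exp (-1 / (4 K t)). -/
theorem lazy_pow_le_shiftPoly {ω K : ℝ} (hω : ω ∈ Set.Ico (1 : ℝ) 2) (hK : K * (2 - ω) = 4)
    {t : ℕ} (ht : K ≤ t) (k : ℕ) {x : ℝ} (hx : x ∈ Set.Icc (-1 : ℝ) 1) :
    ((1 + x) / 2) ^ (t * k) ≤ Real.exp (-(k / (4 * K))) + 4 * (shiftPoly ω t).eval x ^ 2 := by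
  have hK4 : 4 ≤ K := by nlinarith [hω.1, hω.2]
  have ht0 : (0 : ℝ) < t := by linarith
  have h0 : 0 ≤ (1 + x) / 2 := by linarith [hx.1]
  rcases le_total (1 - x) (1 / (2 * K * t)) with h | h
  · have hs : 0 ≤ 1 - x := by linarith [hx.2]
    rw [le_div_iff₀ (by positivity)] at h
    have hKt : K * ((1 - x) * K) ≤ t * ((1 - x) * K) :=
      mul_le_mul_of_nonneg_right ht (by positivity)
    have hP := pow_le_eval_shiftPoly hω hK hs (by nlinarith) t
    have hB := one_add_mul_le_pow (a := -(K * (1 - x))) (by nlinarith) t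
    rw [sub_sub_cancel] at hP
    rw [← sub_eq_add_neg] at hB
    have hP2 : 1 / 2 ≤ (shiftPoly ω t).eval x := by nlinarith
    have h1 : ((1 + x) / 2) ^ (t * k) ≤ 1 := pow_le_one₀ h0 (by linarith [hx.2])
    have := Real.exp_pos (-(k / (4 * K)))
    nlinarith
  · have h1 : (1 + x) / 2 ≤ Real.exp (-(1 / (4 * K * t))) := by
      have := Real.add_one_le_exp (-(1 / (4 * K * t)))
      have h2 : 1 / (4 * K * t) = 1 / (2 * K * t) / 2 := by field_simp; norm_num
      linarith
    refine le_add_of_le_of_nonneg ((pow_le_pow_left₀ h0 h1 _).trans (le_of_eq ?_)) (by positivity)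
    rw [← Real.exp_nat_mul]
    congr 1
    push_cast
    field_simp

/-- `exp (-c t ^ ε)` decays faster than any power of `t`. -/
theorem eventually_exp_neg_rpow_le {c ε : ℝ} (hc : 0 < c) (hε : 0 < ε) (b : ℝ) {η : ℝ}
    (hη : 0 < η) : ∀ᶠ t : ℕ in atTop, Real.exp (-(c * (t : ℝ) ^ ε)) ≤ η * (t : ℝ) ^ (-b) := by
  have h1 : Tendsto (fun t : ℕ => (t : ℝ) ^ ε) atTop atTop :=
    (tendsto_rpow_atTop hε).comp tendsto_natCast_atTop_atTop
  have h2 := (tendsto_rpow_mul_exp_neg_mul_atTop_nhds_zero (b / ε) c hc).comp h1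
  filter_upwards [h2.eventually_lt_const hη, eventually_gt_atTop 0] with t ht ht0
  have htpos : (0 : ℝ) < t := by exact_mod_cast ht0
  simp only [Function.comp_apply] at ht
  rw [← Real.rpow_mul htpos.le, mul_div_cancel₀ b hε.ne', ← neg_mul_eq_neg_mul] at ht
  rw [Real.rpow_neg htpos.le, ← div_eq_mul_inv, le_div_iff₀ (by positivity), mul_comm]
  exact ht.le

theorem HasSpectralDimension.exists_le_rowNormSq_shiftPoly {hW : IsGossipMatrix G W} {v : V}
    {ds : ℝ} (hds : HasSpectralDimension hW v ds) {ω : ℝ} (hω : ω ∈ Set.Ico (1 : ℝ) 2) {r : ℝ}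
    (hr : ds / 2 < r) :
    ∃ c > 0, ∀ᶠ t : ℕ in atTop, c * (t : ℝ) ^ (-r) ≤ hW.rowNormSq v (shiftPoly ω t) := by
  have ha := hds.nonneg
  set a := ds / 2 with hads
  have ha0 : 0 ≤ a := by positivity
  -- Chosen so that (1 + ε)(a + ε) ≤ r: the walk runs for about t^(1 + ε) steps and its decay
  -- exponent is known up to ε.
  obtain ⟨ε, hε, hε1, hεr⟩ : ∃ ε > 0, ε ≤ 1 ∧ ε * (a + 2) ≤ r - a := by
    refine ⟨min 1 ((r - a) / (a + 2)), lt_min one_pos (div_pos (by linarith) (by linarith)),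
      min_le_left _ _, ?_⟩
    rw [← le_div_iff₀ (by linarith)]
    exact min_le_right _ _
  set K := 4 / (2 - ω) with hKdef
  have hω2 : 0 < 2 - ω := by linarith [hω.2]
  have hK : K * (2 - ω) = 4 := by rw [hKdef]; field_simp
  have hK0 : 0 < K := by positivity
  set η : ℝ := 2 ^ (-(a + ε)) with hη
  have hη0 : 0 < η := by positivity
  -- Half of η is lost to the exponential term and the factor 4 to the comparison; η itself pays for
  -- rounding t^ε up to at most 2 t^ε.
  refine ⟨η / 8, by positivity, ?_⟩
  have hT : Tendsto (fun t : ℕ => t * ⌈(t : ℝ) ^ ε⌉₊) atTop atTop := by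
    refine tendsto_atTop_mono' _ ?_ tendsto_id
    filter_upwards [eventually_gt_atTop 0] with t ht
    have : (0 : ℝ) < t := by exact_mod_cast ht
    exact Nat.le_mul_of_pos_right t (Nat.ceil_pos.mpr (by positivity))
  filter_upwards [hT.eventually (hds.eventually_le_returnProb (r := a + ε) (by linarith)),
    eventually_exp_neg_rpow_le (c := 1 / (4 * K)) (by positivity) hε r (half_pos hη0),
    eventually_ge_atTop ⌈K⌉₊, eventually_ge_atTop 1] with t h1 h2 h3 h4
  have ht : (1 : ℝ) ≤ t := by exact_mod_cast h4
  have ht0 : (0 : ℝ) < t := by linarith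
  have hk1 : (1 : ℝ) ≤ (t : ℝ) ^ ε := Real.one_le_rpow ht hε.le
  have hk2 : (⌈(t : ℝ) ^ ε⌉₊ : ℝ) ≤ 2 * (t : ℝ) ^ ε := by
    linarith [Nat.ceil_lt_add_one (show 0 ≤ (t : ℝ) ^ ε by positivity)]
  have hk3 : (t : ℝ) ^ ε ≤ ⌈(t : ℝ) ^ ε⌉₊ := Nat.le_ceil _
  have h5 := hW.returnProb_le_rowNormSq v (shiftPoly ω t) (t * ⌈(t : ℝ) ^ ε⌉₊) 4 _
    (fun x hx => lazy_pow_le_shiftPoly hω hK (Nat.ceil_le.mp h3) _ hx)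
  have h6 : Real.exp (-(⌈(t : ℝ) ^ ε⌉₊ / (4 * K))) ≤ η / 2 * (t : ℝ) ^ (-r) := by
    refine le_trans (Real.exp_le_exp.mpr (neg_le_neg ?_)) h2
    rw [one_div_mul_eq_div]
    gcongr
  have h7 : η * (t : ℝ) ^ (-r) ≤ ((t * ⌈(t : ℝ) ^ ε⌉₊ : ℕ) : ℝ) ^ (-(a + ε)) := by
    have hceil : (0 : ℝ) < ⌈(t : ℝ) ^ ε⌉₊ := by linarith
    calc η * (t : ℝ) ^ (-r) ≤ η * (t : ℝ) ^ ((1 + ε) * (-(a + ε))) := by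
          refine mul_le_mul_of_nonneg_left (Real.rpow_le_rpow_of_exponent_le ht ?_) hη0.le
          nlinarith
      _ = (2 * (t : ℝ) ^ (1 + ε)) ^ (-(a + ε)) := by
          rw [Real.mul_rpow (by norm_num) (by positivity), ← Real.rpow_mul ht0.le]
      _ ≤ _ := by
          refine Real.rpow_le_rpow_of_nonpos (by push_cast; positivity) ?_ (by linarith)
          push_cast
          rw [Real.rpow_add ht0, Real.rpow_one]
          nlinarith
  linarith

/-- Where 1 - x is about 2^(-j), the weighted bound gives p_n² of order n^(-2a) 2^(ja), while ((1 +
x) / 2)^(2^j) ≥ 1/2. The constant term handles x ≤ 0, and the last scale, about n⁻², handles x near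
1 through p_n² ≤ 1. -/
theorem exists_eval_jacobiPoly_sq_le {a : ℝ} (ha : 0 ≤ a) :
    ∃ A : ℝ, 0 < A ∧ ∀ n : ℕ, a + 1 ≤ n → ∀ x ∈ Set.Icc (-1 : ℝ) 1,
      (jacobiPoly (2 * a) n).eval x ^ 2 ≤ A * ((n : ℝ) ^ 2) ^ (-a)
        + ∑ j ∈ Finset.range (Nat.log 2 (n ^ 2) + 1),
          (A * ((n : ℝ) ^ 2) ^ (-a) * ((2 : ℝ) ^ j) ^ a) * ((1 + x) / 2) ^ 2 ^ j := by
  obtain ⟨K, hK1, hK⟩ := exists_rpow_mul_jacobiPoly_sq_le ha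
  have hK0 : 0 < K := by linarith
  have h2a : (1 : ℝ) ≤ 2 ^ a := Real.one_le_rpow one_le_two ha
  refine ⟨2 * 2 ^ a * K, by positivity, fun n hn x hx => ?_⟩
  have hn0 : 0 < (n : ℝ) := by linarith
  have hnn : n ^ 2 ≠ 0 := pow_ne_zero 2 (by rintro rfl; simp at hn0)
  set L := ((n : ℝ) ^ 2) ^ (-a) with hL
  have hL0 : 0 < L := by positivity
  set J := Nat.log 2 (n ^ 2) with hJ
  have hx0 : 0 ≤ (1 + x) / 2 := by linarith [hx.1]
  have hterm : ∀ j, 0 ≤ (2 * 2 ^ a * K * L * ((2 : ℝ) ^ j) ^ a) * ((1 + x) / 2) ^ 2 ^ j :=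
    fun j => by positivity
  have hbound := hK n hn x hx
  rcases le_total 1 (1 - x) with hs | hs
  · refine le_add_of_le_of_nonneg ?_ (Finset.sum_nonneg fun j _ => hterm j)
    have h1 : 1 ≤ (1 - x) ^ a := Real.one_le_rpow hs ha
    calc (jacobiPoly (2 * a) n).eval x ^ 2 ≤ (1 - x) ^ a * (jacobiPoly (2 * a) n).eval x ^ 2 :=
          le_mul_of_one_le_left (sq_nonneg _) h1
      _ ≤ 1 * K * L := by linarith
      _ ≤ 2 * 2 ^ a * K * L := by gcongr; linarith
  have hbern : ∀ j : ℕ, (1 - x) * 2 ^ j ≤ 1 → 1 / 2 ≤ ((1 + x) / 2) ^ 2 ^ j := by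
    intro j hj
    have := one_add_mul_le_pow (a := -((1 - x) / 2)) (by linarith [hx.2]) (2 ^ j)
    push_cast at this
    have h2 : 1 + -((1 - x) / 2) = (1 + x) / 2 := by ring
    rw [h2] at this
    linarith
  suffices h : ∃ j ≤ J, (1 - x) * 2 ^ j ≤ 1 ∧
      (jacobiPoly (2 * a) n).eval x ^ 2 ≤ 2 ^ a * K * L * ((2 : ℝ) ^ j) ^ a by
    obtain ⟨j, hj, hj1, hj2⟩ := h
    refine le_add_of_nonneg_of_le (by positivity) (le_trans ?_ (Finset.single_le_sum
      (fun j _ => hterm j) (Finset.mem_range_succ_iff.mpr hj)))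
    have := mul_le_mul_of_nonneg_left (hbern j hj1)
      (show 0 ≤ 2 * 2 ^ a * K * L * ((2 : ℝ) ^ j) ^ a by positivity)
    linarith
  rcases le_total ((1 - x) * 2 ^ J) 1 with hsJ | hsJ
  · refine ⟨J, le_rfl, hsJ, (jacobiPoly_sq_le_one ha n ⟨by linarith, hx.2⟩).trans ?_⟩
    have h1 : ((n : ℝ) ^ 2) ≤ 2 * 2 ^ J := by
      have := Nat.lt_pow_succ_log_self one_lt_two (n ^ 2)
      rw [← hJ, Nat.succ_eq_add_one, pow_succ' 2 J] at this
      exact_mod_cast this.le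
    calc (1 : ℝ) = ((n : ℝ) ^ 2) ^ a * L := by
          rw [hL, ← Real.rpow_add (by positivity), add_neg_cancel, Real.rpow_zero]
      _ ≤ (2 * 2 ^ J) ^ a * L := by gcongr
      _ = 2 ^ a * 1 * L * ((2 : ℝ) ^ J) ^ a := by
          rw [Real.mul_rpow (by norm_num) (by positivity)]; ring
      _ ≤ _ := by gcongr
  · have hs0 : 0 < 1 - x := by
      by_contra h
      have : (1 - x) * 2 ^ J ≤ 0 := mul_nonpos_of_nonpos_of_nonneg (not_lt.mp h) (by positivity)
      linarith
    obtain ⟨j, hj1, hj2⟩ := exists_nat_pow_near (x := 1 / (1 - x)) (y := (2 : ℝ))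
      (by rw [le_div_iff₀ hs0]; linarith) one_lt_two
    rw [le_div_iff₀ hs0] at hj1
    rw [div_lt_iff₀ hs0] at hj2
    refine ⟨j, ?_, by linarith, ?_⟩
    · have : (2 : ℝ) ^ j ≤ 2 ^ J := by
        refine le_of_mul_le_mul_right ?_ hs0
        linarith
      exact (pow_le_pow_iff_right₀ one_lt_two).mp this
    · have h1 : 1 ≤ (2 * 2 ^ j) ^ a * (1 - x) ^ a := by
        rw [← Real.mul_rpow (by positivity) hs0.le]
        refine Real.one_le_rpow ?_ ha
        rw [← pow_succ']
        exact hj2.le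
      calc (jacobiPoly (2 * a) n).eval x ^ 2
          ≤ ((2 * 2 ^ j) ^ a * (1 - x) ^ a) * (jacobiPoly (2 * a) n).eval x ^ 2 :=
            le_mul_of_one_le_left (sq_nonneg _) h1
        _ = (2 * 2 ^ j) ^ a * ((1 - x) ^ a * (jacobiPoly (2 * a) n).eval x ^ 2) := by ring
        _ ≤ (2 * 2 ^ j) ^ a * (K * L) := by gcongr
        _ = _ := by rw [Real.mul_rpow (by norm_num) (by positivity)]; ring

theorem HasSpectralDimension.exists_rowNormSq_jacobiPoly_le {hW : IsGossipMatrix G W} {v : V}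
    {ds : ℝ} (hds : HasSpectralDimension hW v ds) {r : ℝ} (hr : r < ds) :
    ∃ C > 0, ∀ᶠ n : ℕ in atTop, hW.rowNormSq v (jacobiPoly ds n) ≤ C * (n : ℝ) ^ (-r) := by
  have hds0 := hds.nonneg
  obtain ⟨a, rfl⟩ : ∃ a, ds = 2 * a := ⟨ds / 2, by ring⟩
  have ha : 0 ≤ a := by linarith
  -- Scale j contributes n^(-2a) 2^(εj); the geometric sum up to 2^j ≤ n² gives n^(-2a + 2ε) =
  -- n^(-r).
  set ε := (2 * a - r) / 2 with hεdef
  have hε : 0 < ε := by rw [hεdef]; linarith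
  obtain ⟨K, hK0, hK⟩ := hds.exists_returnProb_le (r := a - ε) (by linarith)
  obtain ⟨A, hA0, hA⟩ := exists_eval_jacobiPoly_sq_le ha
  have h2ε : (1 : ℝ) < 2 ^ ε := Real.one_lt_rpow one_lt_two hε
  refine ⟨A * (1 + K * (2 ^ ε / (2 ^ ε - 1))), ?_, ?_⟩
  · have : 0 < (2 : ℝ) ^ ε - 1 := by linarith
    positivity
  filter_upwards [eventually_ge_atTop ⌈a + 1⌉₊] with n hn
  have hn1 : a + 1 ≤ n := Nat.ceil_le.mp hn
  have hn0 : (1 : ℝ) ≤ n := by linarith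
  have hnn : n ^ 2 ≠ 0 := pow_ne_zero 2 (by rintro rfl; norm_num at hn0)
  set L := ((n : ℝ) ^ 2) ^ (-a) with hL
  have hL0 : 0 < L := by positivity
  have hgeom : ∑ j ∈ Finset.range (Nat.log 2 (n ^ 2) + 1), ((2 : ℝ) ^ ε) ^ j
      ≤ 2 ^ ε / (2 ^ ε - 1) * ((n : ℝ) ^ 2) ^ ε := by
    rw [geom_sum_eq h2ε.ne', div_mul_eq_mul_div]
    have h1 : ((2 : ℝ) ^ ε) ^ (Nat.log 2 (n ^ 2)) ≤ ((n : ℝ) ^ 2) ^ ε := by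
      rw [← Real.rpow_natCast, ← Real.rpow_mul zero_le_two, mul_comm, Real.rpow_mul zero_le_two,
        Real.rpow_natCast]
      refine Real.rpow_le_rpow (by positivity) ?_ hε.le
      exact_mod_cast Nat.pow_log_le_self 2 hnn
    rw [pow_succ']
    refine div_le_div_of_nonneg_right ?_ (by linarith)
    have := mul_le_mul_of_nonneg_left h1 (show (0 : ℝ) ≤ 2 ^ ε by positivity)
    linarith
  have hterm : ∀ j : ℕ, (A * L * ((2 : ℝ) ^ j) ^ a) * returnProb hW v (2 ^ j)
      ≤ A * L * K * ((2 : ℝ) ^ ε) ^ j := by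
    intro j
    have h1 := hK (2 ^ j) Nat.one_le_two_pow
    push_cast at h1
    calc (A * L * ((2 : ℝ) ^ j) ^ a) * returnProb hW v (2 ^ j)
        ≤ (A * L * ((2 : ℝ) ^ j) ^ a) * (K * ((2 : ℝ) ^ j) ^ (-(a - ε))) := by gcongr
      _ = A * L * K * (((2 : ℝ) ^ j) ^ a * ((2 : ℝ) ^ j) ^ (-(a - ε))) := by ring
      _ = A * L * K * ((2 : ℝ) ^ ε) ^ j := by
          rw [← Real.rpow_add (by positivity), ← Real.rpow_natCast, ← Real.rpow_natCast,
            ← Real.rpow_mul zero_le_two, ← Real.rpow_mul zero_le_two]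
          congr 2
          ring
  have hmain := hW.rowNormSq_le v (jacobiPoly (2 * a) n) _ _ _ _ (hA n hn1)
  have hn2 : 1 ≤ ((n : ℝ) ^ 2) ^ ε := Real.one_le_rpow (by nlinarith) hε.le
  calc hW.rowNormSq v (jacobiPoly (2 * a) n)
      ≤ A * L + ∑ j ∈ Finset.range (Nat.log 2 (n ^ 2) + 1), A * L * K * ((2 : ℝ) ^ ε) ^ j :=
        hmain.trans (add_le_add_right (Finset.sum_le_sum fun j _ => hterm j) _)
    _ ≤ A * L * ((n : ℝ) ^ 2) ^ ε + A * L * K * (2 ^ ε / (2 ^ ε - 1) * ((n : ℝ) ^ 2) ^ ε) := by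
        rw [← Finset.mul_sum]
        refine add_le_add (le_mul_of_one_le_right (by positivity) hn2) ?_
        gcongr
    _ = A * (1 + K * (2 ^ ε / (2 ^ ε - 1))) * (L * ((n : ℝ) ^ 2) ^ ε) := by ring
    _ = _ := by
        rw [hL, ← Real.rpow_add (by positivity), ← Real.rpow_natCast,
          ← Real.rpow_mul (by positivity)]
        congr 2
        rw [hεdef]
        push_cast
        ring

end Gossip

/-! ### Mean square error of linear combinations of i.i.d. variables. -/

namespace Gossip

/-- Fubini on the product law: X + y is square integrable for almost every constant y, hence for
some y. -/
theorem memLp_two_of_indepFun_add {Ω : Type*} [MeasurableSpace Ω] {P : Measure Ω}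
    [IsProbabilityMeasure P] {X Y : Ω → ℝ} (hX : AEMeasurable X P) (hY : AEMeasurable Y P)
    (hXY : IndepFun X Y P) (h : MemLp (X + Y) 2 P) : MemLp X 2 P := by
  have : IsProbabilityMeasure (P.map X) := Measure.isProbabilityMeasure_map hX
  have : IsProbabilityMeasure (P.map Y) := Measure.isProbabilityMeasure_map hY
  have h1 : MemLp (fun z : ℝ × ℝ => z.1 + z.2) 2 ((P.map X).prod (P.map Y)) := by
    rw [← (indepFun_iff_map_prod_eq_prod_map_map hX hY).mp hXY,
      memLp_map_measure_iff (by fun_prop) (by fun_prop)]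
    exact h
  obtain ⟨y, hy⟩ := h1.integrable_sq.prod_left_ae.exists
  have h2 : MemLp (fun x : ℝ => x + y) 2 (P.map X) :=
    (memLp_two_iff_integrable_sq (by fun_prop)).mpr hy
  have h3 : MemLp (fun x : ℝ => x) 2 (P.map X) := by
    convert h2.sub (memLp_const y) using 1
    ext x
    simp
  rwa [memLp_map_measure_iff (by fun_prop) hX] at h3

section IID

variable {V : Type*} {ν : Measure ℝ} {Ω : Type*} [MeasurableSpace Ω] {P : Measure Ω}
  {ξ : V → Ω → ℝ} {B : Finset V}

theorem mse_eq_evariance (hν : Integrable (fun x : ℝ => x) ν) (hξ_law : ∀ w, HasLaw (ξ w) ν P)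
    {c : B → ℝ} (hc : ∑ w, c w = 1) :
    mse P (fun s => ∑ w, c w * ξ w s) (∫ x, x ∂ν)
      = evariance (fun s => ∑ w, c w * ξ w s) P := by
  have hint : ∀ w, Integrable (ξ w) P := by
    intro w
    have h := hν
    rw [← (hξ_law w).map_eq] at h
    exact (integrable_map_measure (by fun_prop) (hξ_law w).aemeasurable).mp h
  rw [evariance_eq_lintegral_ofReal, integral_finsetSum (f := fun (w : B) s => c w * ξ w s) _
    fun w _ => (hint w).const_mul _]
  simp_rw [integral_const_mul, (hξ_law _).integral_eq]
  rw [← Finset.sum_mul, hc, one_mul]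
  rfl

variable [IsProbabilityMeasure P]

theorem mse_eq_ofReal [IsProbabilityMeasure ν] (hξ_indep : iIndepFun ξ P)
    (hξ_law : ∀ w, HasLaw (ξ w) ν P) (hν2 : MemLp (fun x : ℝ => x) 2 ν)
    {c : B → ℝ} (hc : ∑ w, c w = 1) :
    mse P (fun s => ∑ w, c w * ξ w s) (∫ x, x ∂ν)
      = ENNReal.ofReal (Var[fun x : ℝ => x; ν] * ∑ w, c w ^ 2) := by
  have hmem : ∀ w : B, MemLp (fun s => c w * ξ w s) 2 P := by
    intro w
    have h := hν2
    rw [← (hξ_law w).map_eq, memLp_map_measure_iff (by fun_prop) (hξ_law w).aemeasurable] at h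
    exact h.const_mul _
  have hsum : (fun s => ∑ w, c w * ξ w s) = ∑ w : B, fun s => c w * ξ w s := by
    ext s
    simp
  rw [mse_eq_evariance (hν2.integrable one_le_two) hξ_law hc, hsum,
    ← ofReal_variance (memLp_finsetSum' _ fun w _ => hmem w),
    IndepFun.variance_sum (fun w _ => hmem w) fun i _ j _ hij =>
      (hξ_indep.indepFun (Subtype.coe_injective.ne hij)).comp
        (measurable_const_mul (c i)) (measurable_const_mul (c j))]
  simp_rw [variance_const_mul, (hξ_law _).variance_eq]
  rw [← Finset.sum_mul, mul_comm]
  rfl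

theorem mse_eq_top (hν : Integrable (fun x : ℝ => x) ν) (hξ_indep : iIndepFun ξ P)
    (hξ_law : ∀ w, HasLaw (ξ w) ν P) (hν2 : ¬ MemLp (fun x : ℝ => x) 2 ν) {c : B → ℝ}
    (hc : ∑ w, c w = 1) : mse P (fun s => ∑ w, c w * ξ w s) (∫ x, x ∂ν) = ⊤ := by
  classical
  have hae : ∀ w : B, AEMeasurable (fun s => c w * ξ w s) P := fun w =>
    (hξ_law w).aemeasurable.const_mul _
  have hsum : (fun s => ∑ w, c w * ξ w s) = ∑ w : B, fun s => c w * ξ w s := by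
    ext s
    simp
  rw [mse_eq_evariance hν hξ_law hc, hsum, evariance_eq_top_iff
    (Finset.aemeasurable_sum _ fun w _ => hae w).aestronglyMeasurable]
  intro h
  -- Since the coefficients sum to 1, some c i is nonzero, and its term is independent of the
  -- remaining sum.
  obtain ⟨i, -, hi⟩ := Finset.exists_ne_zero_of_sum_ne_zero (hc.trans_ne one_ne_zero)
  have hind : iIndepFun (fun (w : B) s => c w * ξ w s) P :=
    (hξ_indep.precomp (g := ((↑) : B → V)) Subtype.coe_injective).comp
      (fun w x => c w * x) fun w => measurable_const_mul (c w)
  rw [← Finset.add_sum_erase _ _ (Finset.mem_univ i)] at h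
  have hi2 := memLp_two_of_indepFun_add (hae i) (Finset.aemeasurable_sum _ fun w _ => hae w)
    (hind.indepFun_finsetSum_of_notMem₀ hae (Finset.notMem_erase i _)).symm h
  have hi3 : MemLp (ξ i) 2 P := by
    convert hi2.const_mul (c i)⁻¹ using 1
    ext s
    field_simp
  refine hν2 ?_
  rw [← (hξ_law i).map_eq, memLp_map_measure_iff (by fun_prop) (hξ_law i).aemeasurable]
  exact hi3

end IID

/-! ### Logarithmic rates and conclusion. -/

theorem le_liminf_logRate {e : ℕ → ENNReal} {a : ℝ}
    (h : ∀ r > a, ∃ c > 0, ∀ᶠ t : ℕ in atTop, ENNReal.ofReal (c * (t : ℝ) ^ (-r)) ≤ e t) :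
    ((-a : ℝ) : EReal) ≤ liminf (logRate e) atTop := by
  refine EReal.ge_of_forall_gt_iff_ge.mp fun z hz => ?_
  have hz' : z < -a := by exact_mod_cast hz
  -- The midpoint of a and -z: the spare power of t absorbs c.
  obtain ⟨c, hc, hce⟩ := h ((a - z) / 2) (by linarith)
  have hlim : Tendsto (fun t : ℕ => c * (t : ℝ) ^ ((-a - z) / 2)) atTop atTop :=
    ((tendsto_rpow_atTop (by linarith)).comp tendsto_natCast_atTop_atTop).const_mul_atTop hc
  refine le_liminf_of_le (h := ?_)
  filter_upwards [hce, hlim.eventually_ge_atTop 1, eventually_ge_atTop 2] with t h1 h2 h3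
  have ht : (1 : ℝ) < t := by exact_mod_cast h3
  have ht0 : (0 : ℝ) < t := by linarith
  have hlog : 0 < Real.log t := Real.log_pos ht
  have h4 : (t : ℝ) ^ z ≤ c * (t : ℝ) ^ (-((a - z) / 2)) := by
    have : (t : ℝ) ^ (-((a - z) / 2)) = (t : ℝ) ^ ((-a - z) / 2) * (t : ℝ) ^ z := by
      rw [← Real.rpow_add ht0]
      congr 1
      ring
    rw [this, ← mul_assoc]
    exact le_mul_of_one_le_left (by positivity) h2
  have h5 : ENNReal.log (ENNReal.ofReal ((t : ℝ) ^ z)) ≤ ENNReal.log (e t) :=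
    ENNReal.log_le_log ((ENNReal.ofReal_le_ofReal h4).trans h1)
  rw [ENNReal.log_ofReal_of_pos (by positivity), Real.log_rpow ht0] at h5
  rw [logRate, EReal.le_div_iff_mul_le (by exact_mod_cast hlog) (EReal.coe_ne_top _)]
  exact_mod_cast h5

theorem limsup_logRate_le {e : ℕ → ENNReal} {b : ℝ}
    (h : ∀ r < b, ∃ C > 0, ∀ᶠ t : ℕ in atTop, e t ≤ ENNReal.ofReal (C * (t : ℝ) ^ (-r))) :
    limsup (logRate e) atTop ≤ ((-b : ℝ) : EReal) := by
  refine EReal.le_of_forall_lt_iff_le.mp fun z hz => ?_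
  have hz' : -b < z := by exact_mod_cast hz
  obtain ⟨C, hC, hCe⟩ := h ((b - z) / 2) (by linarith)
  have hlim : Tendsto (fun t : ℕ => (t : ℝ) ^ ((b + z) / 2)) atTop atTop :=
    (tendsto_rpow_atTop (by linarith)).comp tendsto_natCast_atTop_atTop
  refine limsup_le_of_le (h := ?_)
  filter_upwards [hCe, hlim.eventually_ge_atTop C, eventually_ge_atTop 2] with t h1 h2 h3
  have ht : (1 : ℝ) < t := by exact_mod_cast h3
  have ht0 : (0 : ℝ) < t := by linarith
  have hlog : 0 < Real.log t := Real.log_pos ht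
  have h4 : C * (t : ℝ) ^ (-((b - z) / 2)) ≤ (t : ℝ) ^ z := by
    have : (t : ℝ) ^ z = (t : ℝ) ^ ((b + z) / 2) * (t : ℝ) ^ (-((b - z) / 2)) := by
      rw [← Real.rpow_add ht0]
      congr 1
      ring
    rw [this]
    gcongr
  have h5 : ENNReal.log (e t) ≤ ENNReal.log (ENNReal.ofReal ((t : ℝ) ^ z)) :=
    ENNReal.log_le_log (h1.trans (ENNReal.ofReal_le_ofReal h4))
  rw [ENNReal.log_ofReal_of_pos (by positivity), Real.log_rpow ht0] at h5
  rw [logRate, EReal.div_le_iff_le_mul (by exact_mod_cast hlog) (EReal.coe_ne_top _)]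
  rw [mul_comm]
  exact_mod_cast h5

section Rates

variable {V : Type*} {G : SimpleGraph V} {W : Matrix V V ℝ} {hW : IsGossipMatrix G W}
  {ν : Measure ℝ} [IsProbabilityMeasure ν] {Ω : Type*} [MeasurableSpace Ω]
  {P : Measure Ω} [IsProbabilityMeasure P] {ξ : V → Ω → ℝ} {v : V} {ds : ℝ}

theorem HasSpectralDimension.le_liminf_shiftRegister (hds : HasSpectralDimension hW v ds)
    (hν : Integrable (fun x : ℝ => x) ν) (hξ_indep : iIndepFun ξ P)
    (hξ_law : ∀ w, HasLaw (ξ w) ν P) (hvar : evariance (fun x : ℝ => x) ν ≠ 0)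
    {ω : ℝ} (hω : ω ∈ Set.Ico (1 : ℝ) 2) :
    ((-(ds / 2) : ℝ) : EReal) ≤ liminf (logRate fun t =>
      mse P (fun s => shiftRegister ω W (fun w => ξ w s) t v) (∫ x, x ∂ν)) atTop := by
  refine le_liminf_logRate fun r hr => ?_
  obtain ⟨c, hc, hev⟩ := hds.exists_le_rowNormSq_shiftPoly hω hr
  by_cases hν2 : MemLp (fun x : ℝ => x) 2 ν
  · have hpos : 0 < Var[fun x : ℝ => x; ν] :=
      ENNReal.toReal_pos hvar (evariance_ne_top hν2)
    refine ⟨Var[fun x : ℝ => x; ν] * c, by positivity, hev.mono fun t ht => ?_⟩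
    obtain ⟨B, d, hd, hd2, hd1⟩ := hW.exists_row v (shiftPoly ω t)
    simp_rw [hW.shiftRegister_eq, hd]
    rw [mse_eq_ofReal hξ_indep hξ_law hν2 (hd1.trans (eval_one_shiftPoly ω t)), hd2, mul_assoc]
    exact ENNReal.ofReal_le_ofReal (mul_le_mul_of_nonneg_left ht hpos.le)
  · refine ⟨1, one_pos, Eventually.of_forall fun t => ?_⟩
    obtain ⟨B, d, hd, hd2, hd1⟩ := hW.exists_row v (shiftPoly ω t)
    simp_rw [hW.shiftRegister_eq, hd]
    rw [mse_eq_top hν hξ_indep hξ_law hν2 (hd1.trans (eval_one_shiftPoly ω t))]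
    exact le_top

theorem HasSpectralDimension.limsup_jacobiIteration_le (hds : HasSpectralDimension hW v ds)
    (hξ_indep : iIndepFun ξ P) (hξ_law : ∀ w, HasLaw (ξ w) ν P)
    (hvar : evariance (fun x : ℝ => x) ν ≠ ⊤) :
    limsup (logRate fun t =>
      mse P (fun s => jacobiIteration ds W (fun w => ξ w s) t v) (∫ x, x ∂ν)) atTop
        ≤ ((-ds : ℝ) : EReal) := by
  have hν2 : MemLp (fun x : ℝ => x) 2 ν :=
    (evariance_lt_top_iff_memLp (by fun_prop)).mp hvar.lt_top
  refine limsup_logRate_le fun r hr => ?_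
  obtain ⟨C, hC, hev⟩ := hds.exists_rowNormSq_jacobiPoly_le hr
  have hnn : 0 ≤ Var[fun x : ℝ => x; ν] := variance_nonneg _ _
  -- The added 1 keeps the constant positive when ν is a point mass.
  refine ⟨(Var[fun x : ℝ => x; ν] + 1) * C, by positivity, hev.mono fun t ht => ?_⟩
  obtain ⟨B, d, hd, hd2, hd1⟩ := hW.exists_row v (jacobiPoly ds t)
  have hone : (jacobiPoly ds t).eval 1 = 1 := by
    have h := eval_one_jacobiPoly (a := ds / 2) (by linarith [hds.nonneg]) t
    rwa [mul_div_cancel₀ ds two_ne_zero] at h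
  simp_rw [hW.jacobiIteration_eq, hd]
  rw [mse_eq_ofReal hξ_indep hξ_law hν2 (hd1.trans hone), hd2, mul_assoc]
  refine ENNReal.ofReal_le_ofReal ?_
  have : 0 ≤ C * (t : ℝ) ^ (-r) := by positivity
  calc _ ≤ Var[fun x : ℝ => x; ν] * (C * (t : ℝ) ^ (-r)) := mul_le_mul_of_nonneg_left ht hnn
    _ ≤ _ := by linarith

end Rates

end Gossip

theorem mainTheorem1 {V : Type*} (G : SimpleGraph V) [G.LocallyFinite]
    (W : Matrix V V ℝ) (hW : Gossip.IsGossipMatrix G W)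
    (ν : Measure ℝ) [IsProbabilityMeasure ν] (hν : Integrable (fun x : ℝ => x) ν)
    (μ : ℝ) (hμ : μ = ∫ x, x ∂ν)
    {Ω : Type*} [MeasurableSpace Ω] (P : Measure Ω) [IsProbabilityMeasure P]
    (ξ : V → Ω → ℝ) (hξ_indep : iIndepFun ξ P) (hξ_law : ∀ w, HasLaw (ξ w) ν P)
    (v : V) (ds : ℝ) (hds : Gossip.HasSpectralDimension hW v ds) :
    (evariance (fun x : ℝ => x) ν ≠ 0 →
      ((-(ds / 2) : ℝ) : EReal) ≤ liminf (Gossip.logRate fun t =>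
          Gossip.mse P (fun s => Gossip.simpleGossip W (fun w => ξ w s) t v) μ) atTop
      ∧ ∀ ω ∈ Set.Ico (1 : ℝ) 2,
        ((-(ds / 2) : ℝ) : EReal) ≤ liminf (Gossip.logRate fun t =>
          Gossip.mse P (fun s => Gossip.shiftRegister ω W (fun w => ξ w s) t v) μ) atTop)
    ∧ (evariance (fun x : ℝ => x) ν ≠ ⊤ →
      limsup (Gossip.logRate fun t =>
          Gossip.mse P (fun s => Gossip.jacobiIteration ds W (fun w => ξ w s) t v) μ) atTop
        ≤ ((-ds : ℝ) : EReal)) := by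
  subst hμ
  refine ⟨fun hvar => ⟨?_, fun ω hω =>
    hds.le_liminf_shiftRegister hν hξ_indep hξ_law hvar hω⟩,
    fun hvar => hds.limsup_jacobiIteration_le hξ_indep hξ_law hvar⟩
  simp_rw [Gossip.simpleGossip_eq_shiftRegister]
  exact hds.le_liminf_shiftRegister hν hξ_indep hξ_law hvar ⟨le_rfl, one_lt_two⟩
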